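/- **Fermions.** Let $K$ be a field of characteristic $0$ (for instance $\mathbb C$, or a field of rational functions if the parameters below are formal variables). The fermionic Fock space has as basis the Maya diagrams, i.e. the sets of occupied half-integer positions in which only finitely many positive positions are occupied and only finitely many negative ones are empty. For $k\in\mathbb Z-\frac12$ the operator $\psi_k^*$ (resp. $\psi_k$) creates (resp. removes) a particle at $k$, with sign $(-1)^{\#\{\text{particles to the right of }k\}}$, and gives $0$ if this is impossible; so $[\psi_i,\psi_j]_+=[\psi_i^*,\psi_j^*]_+=0$ and $[\psi_i,\psi_j^*]_+=\delta_{ij}$. The vacuum $|\emptyset\rangle$ has exactly the negative positions occupied, and $\langle\emptyset|$ denotes taking the coefficient of $|\emptyset\rangle$. For $\mu=(\mu_1>\dots>\mu_r>0)$ put $|\mu\rangle=\psi^*_{\mu_1-\frac12}\cdots\psi^*_{\mu_r-\frac12}|\emptyset\rangle$ and $\langle\mu|=\langle\emptyset|\psi_{\mu_r-\frac12}\cdots\psi_{\mu_1-\frac12}$. Let $J_n=\sum_{i\in\mathbb Z-\frac12}:\!\psi^*_{i-n}\psi_i\!:$, where $:\!\psi_i^*\psi_j\!:$ is $\psi_i^*\psi_j$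 for $i>0$ and $-\psi_j\psi_i^*$ for $i<0$, and $$\phi_\pm(x;t)=\sum_{q\ge1}\frac{1-(-t)^q}{q}\,x^{\pm q}J_{\pm q},\qquad e^{\phi_\pm(x;t)}=\sum_{k\ge0}\frac{\phi_\pm(x;t)^k}{k!}.$$ Bra-kets of these formal sums are evaluated term by term; the ones below are finite sums. **Ice.** Let $\lambda=(\lambda_1>\dots>\lambda_n>0)$ with $n\ge1$. A state $A$ of non-nested bent ice $\mathfrak C^\lambda_{\mathrm{NN}}$ is an orientation of the edges of a square lattice with rows $n,\bar n,\dots,1,\bar1$ (top to bottom) and columns $\lambda_1,\dots,1$ (left to right), in which, for each $i$, the right ends of the rows $i$ and $\bar i$ are joined by a bend. It is required that every vertex has in-degree equal to out-degree; that each bend is consistently oriented (one of the right ends of rows $i,\bar i$ points right, the other left); that left boundary edges point right; that bottom boundary edges point down; and that the top boundary edge of a column points up if and only if the column's number is a part of $\lambda$. For $1\le i\le n$ let $\lambda^{(i)}$ (resp. $\lambda^{(\bar i)}$) be the strictly decreasing list of the columns in which the edge north of row $i$ (resp. $\bar i$) points up, and $\lambda^{(0)}=\emptyset$. Write a vertex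 as (west, east; north, south), with each edge's orientation given by an arrow. The weights of the six kinds of vertices, with parameters $x,t$, are | | $(\to,\to;\downarrow,\downarrow)$ | $(\leftarrow,\leftarrow;\uparrow,\uparrow)$ | $(\to,\to;\uparrow,\uparrow)$ | $(\leftarrow,\leftarrow;\downarrow,\downarrow)$ | $(\leftarrow,\to;\downarrow,\uparrow)$ | $(\to,\leftarrow;\uparrow,\downarrow)$ | |---|---|---|---|---|---|---| | $\Delta$ | $1$ | $tx$ | $1$ | $x$ | $x(t+1)$ | $1$ | | $\Gamma$ | $1$ | $x$ | $t$ | $x$ | $x(t+1)$ | $1$ | Let $x_1,\dots,x_n\in K$ be nonzero and $t\in K$ with $t\ne-1$. The weight $\mathrm{wt}_{\Delta\Gamma'}(A;(i,\bar i))$ of the double row $(i,\bar i)$ is the product of the $\Delta$ weights with parameters $x_i,t$ of the vertices in row $i$, the $\Gamma$ weights with parameters $x_i^{-1},t$ of the vertices in row $\bar i$, and the weight of the bend, which is $tx_i$ if the bend is oriented upward (the right end of row $i$ points left) and $x_i^{-1}$ if it is oriented downward. **Statement.** For every state $A$ of $\mathfrak C^\lambda_{\mathrm{NN}}$ and every $1\le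 i\le n$, $$\mathrm{wt}_{\Delta\Gamma'}(A;(i,\bar i))=\Big\langle\lambda^{(i-1)}\Big|\big(\beta_1\psi^*_{-\frac12}+\beta_2\big)\,\psi_{\lambda_1+\frac12}\,e^{\phi_-(x_i^{-1};t)}\Big|\lambda^{(\bar i)}\Big\rangle\ \Big\langle\lambda^{(\bar i)}\Big|e^{\phi_+(x_i;t)}\big(\alpha_1\psi_{-\frac12}+\alpha_2\big)\Big|\lambda^{(i)}\Big\rangle,$$ where $$\alpha_1=\frac{t}{(-1)^i(t+1)},\quad\alpha_2=x_i^{-1},\quad\beta_1=\frac{(-1)^{i-1}}{(t+1)\,x_i^{\lambda_1+1}},\quad\beta_2=\frac{1}{(t+1)\,x_i^{\lambda_1}}.$$ -/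

import Mathlib

/-! ## Fermionic Fock space

Fermions sit at half-integer positions.  Throughout, the integer `k` stands for the position
`k - 1/2`; so `psi 0` is `ψ_{-1/2}`, `psi (m + 1)` is `ψ_{m+1/2}`, and a part `m` of a partition
stands for a particle at `m - 1/2`. -/

namespace SixVertex

/-- A Maya diagram: a set of occupied positions in which only finitely many positive positions are
occupied and only finitely many negative ones are empty. -/
def Maya : Type :=
  {S : Set ℤ // {k | k ∈ S ∧ 0 < k}.Finite ∧ {k | k ∉ S ∧ k ≤ 0}.Finite}

namespace Maya

/-- The vacuum: exactly the negative half-integer positions are occupied. -/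
def vac : Maya :=
  ⟨{k | k ≤ 0}, by
    have h : {k : ℤ | k ∈ {k : ℤ | k ≤ 0} ∧ 0 < k} = ∅ := by
      ext k; simp
    have h' : {k : ℤ | k ∉ {k : ℤ | k ≤ 0} ∧ k ≤ 0} = ∅ := by
      ext k; simp
    rw [h, h']
    exact ⟨Set.finite_empty, Set.finite_empty⟩⟩

/-- Fill position `k`. -/
def fill (S : Maya) (k : ℤ) : Maya :=
  ⟨insert k S.1, by
    constructor
    · refine (S.2.1.union (Set.finite_singleton k)).subset ?_
      rintro j ⟨hj, h0⟩
      rcases hj with rfl | hj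
      · exact Or.inr rfl
      · exact Or.inl ⟨hj, h0⟩
    · refine S.2.2.subset ?_
      rintro j ⟨hj, h0⟩
      exact ⟨fun h => hj (Or.inr h), h0⟩⟩

/-- Empty position `k`. -/
def clear (S : Maya) (k : ℤ) : Maya :=
  ⟨S.1 \ {k}, by
    constructor
    · refine S.2.1.subset ?_
      rintro j ⟨hj, h0⟩
      exact ⟨hj.1, h0⟩
    · refine (S.2.2.union (Set.finite_singleton k)).subset ?_
      rintro j ⟨hj, h0⟩
      by_cases h : j = k
      · exact Or.inr h
      · exact Or.inl ⟨fun h1 => hj ⟨h1, h⟩, h0⟩⟩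

/-- The number of particles strictly to the right of position `k`. -/
noncomputable def above (S : Maya) (k : ℤ) : ℕ := {j | j ∈ S.1 ∧ k < j}.ncard

theorem finite_above (S : Maya) (k : ℤ) : {j | j ∈ S.1 ∧ k < j}.Finite := by
  refine (S.2.1.union (Set.finite_Ioc k 0)).subset ?_
  rintro j ⟨hj, hk⟩
  by_cases h : 0 < j
  · exact Or.inl ⟨hj, h⟩
  · exact Or.inr ⟨hk, not_lt.mp h⟩

theorem above_fill_of_lt (S : Maya) {j k : ℤ} (hj : j ∉ S.1) (h : k < j) :
    (S.fill j).above k = S.above k + 1 := by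
  have : {i | i ∈ (S.fill j).1 ∧ k < i} = insert j {i | i ∈ S.1 ∧ k < i} := by
    ext i
    simp only [fill, Set.mem_insert_iff, Set.mem_ofPred_eq]
    constructor
    · rintro ⟨rfl | h1, h2⟩
      · exact Or.inl rfl
      · exact Or.inr ⟨h1, h2⟩
    · rintro (rfl | ⟨h1, h2⟩)
      · exact ⟨Or.inl rfl, h⟩
      · exact ⟨Or.inr h1, h2⟩
  unfold above
  rw [this, Set.ncard_insert_of_notMem (fun h1 => hj h1.1) (S.finite_above k)]

theorem above_fill_of_le (S : Maya) {j k : ℤ} (h : j ≤ k) :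
    (S.fill j).above k = S.above k := by
  have : {i | i ∈ (S.fill j).1 ∧ k < i} = {i | i ∈ S.1 ∧ k < i} := by
    ext i
    simp only [fill, Set.mem_insert_iff, Set.mem_ofPred_eq]
    constructor
    · rintro ⟨rfl | h1, h2⟩
      · omega
      · exact ⟨h1, h2⟩
    · rintro ⟨h1, h2⟩
      exact ⟨Or.inr h1, h2⟩
  unfold above
  rw [this]

theorem mem_fill (S : Maya) (j k : ℤ) : k ∈ (S.fill j).1 ↔ k = j ∨ k ∈ S.1 := Iff.rfl

theorem mem_clear (S : Maya) (j k : ℤ) : k ∈ (S.clear j).1 ↔ k ∈ S.1 ∧ k ≠ j := Iff.rfl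

theorem fill_clear (S : Maya) {k : ℤ} (h : k ∈ S.1) : (S.clear k).fill k = S := by
  apply Subtype.ext
  simp only [fill, clear, Set.insert_sdiff_singleton]
  exact Set.insert_eq_of_mem h

theorem clear_fill (S : Maya) {k : ℤ} (h : k ∉ S.1) : (S.fill k).clear k = S := by
  apply Subtype.ext
  simp only [fill, clear]
  ext i
  simp only [Set.mem_sdiff, Set.mem_insert_iff, Set.mem_singleton_iff]
  constructor
  · rintro ⟨h1 | h1, h2⟩
    · exact absurd h1 h2
    · exact h1
  · intro h1
    exact ⟨Or.inr h1, fun h2 => h (h2 ▸ h1)⟩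

theorem above_clear_of_lt (S : Maya) {j k : ℤ} (hj : j ∈ S.1) (h : k < j) :
    (S.clear j).above k + 1 = S.above k := by
  conv_rhs => rw [← S.fill_clear hj]
  rw [above_fill_of_lt _ (by simp [clear]) h]

theorem above_clear_of_le (S : Maya) {j k : ℤ} (hj : j ∈ S.1) (h : j ≤ k) :
    (S.clear j).above k = S.above k := by
  conv_rhs => rw [← S.fill_clear hj]
  rw [above_fill_of_le _ h]

end Maya

/-- Fermionic Fock space over `K`: the vector space whose basis vectors are the Maya diagrams. -/
abbrev Fock (K : Type*) [Field K] : Type _ := Maya →₀ K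

section Operators

open Classical in
/-- The operator `ψ_{k-1/2}`: it removes the particle at `k - 1/2`, with sign `-1` to the number of
particles further to the right, and kills a state that has no particle there. -/
noncomputable def psi {K : Type*} [Field K] (k : ℤ) : Module.End K (Fock K) :=
  Finsupp.linearCombination K fun S : Maya =>
    if k ∈ S.1 then (-1 : K) ^ S.above k • Finsupp.single (S.clear k) (1 : K) else 0

open Classical in
/-- The operator `ψ*_{k-1/2}`: it creates a particle at `k - 1/2`, with sign `-1` to the number of
particles further to the right, and kills a state that already has a particle there. -/
noncomputable def psiStar {K : Type*} [Field K] (k : ℤ) : Module.End K (Fock K) :=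
  Finsupp.linearCombination K fun S : Maya =>
    if k ∈ S.1 then 0 else (-1 : K) ^ S.above k • Finsupp.single (S.fill k) (1 : K)

/-- The vacuum vector `|0⟩`. -/
noncomputable def vacuum {K : Type*} [Field K] : Fock K := Finsupp.single Maya.vac 1

/-- The vacuum expectation value `⟨0| a |0⟩`. -/
noncomputable def vev {K : Type*} [Field K] (a : Module.End K (Fock K)) : K :=
  a vacuum Maya.vac

end Operators

section Facts

variable {K : Type*} [Field K]

theorem psi_of_mem {k : ℤ} {S : Maya} (h : k ∈ S.1) :
    psi k (Finsupp.single S (1 : K)) = (-1 : K) ^ S.above k • Finsupp.single (S.clear k) 1 := by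
  simp [psi, Finsupp.linearCombination_single, h]

theorem psi_of_notMem {k : ℤ} {S : Maya} (h : k ∉ S.1) :
    psi k (Finsupp.single S (1 : K)) = 0 := by
  simp [psi, Finsupp.linearCombination_single, h]

theorem psiStar_of_mem {k : ℤ} {S : Maya} (h : k ∈ S.1) :
    psiStar k (Finsupp.single S (1 : K)) = 0 := by
  simp [psiStar, Finsupp.linearCombination_single, h]

theorem psiStar_of_notMem {k : ℤ} {S : Maya} (h : k ∉ S.1) :
    psiStar k (Finsupp.single S (1 : K)) =
      (-1 : K) ^ S.above k • Finsupp.single (S.fill k) 1 := by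
  simp [psiStar, Finsupp.linearCombination_single, h]

theorem end_ext {a b : Module.End K (Fock K)}
    (h : ∀ S : Maya, a (Finsupp.single S 1) = b (Finsupp.single S 1)) : a = b := by
  refine Finsupp.lhom_ext' fun S => LinearMap.ext_ring ?_
  simpa using h S

theorem neg_one_pow_add_one (n : ℕ) : (-1 : K) ^ (n + 1) = -(-1) ^ n := by
  rw [pow_succ]; ring

/-- Clifford relation `[ψ*_i, ψ*_j]_+ = 0`. -/
theorem psiStar_anticomm (i j : ℤ) :
    psiStar (K := K) i * psiStar j + psiStar j * psiStar i = 0 := by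
  wlog hij : i ≤ j generalizing i j
  · rw [add_comm]; exact this j i (by omega)
  apply end_ext
  intro S
  simp only [LinearMap.add_apply, Module.End.mul_apply, LinearMap.zero_apply]
  by_cases hi : i ∈ S.1
  · rw [psiStar_of_mem hi, map_zero, add_zero]
    by_cases hj : j ∈ S.1
    · rw [psiStar_of_mem hj, map_zero]
    · rw [psiStar_of_notMem hj, map_smul, psiStar_of_mem (Or.inr hi), smul_zero]
  · by_cases hj : j ∈ S.1
    · rw [psiStar_of_mem hj, map_zero, psiStar_of_notMem hi, map_smul,
        psiStar_of_mem (Or.inr hj), smul_zero, add_zero]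
    · rw [psiStar_of_notMem hi, psiStar_of_notMem hj, map_smul, map_smul]
      rcases hij.eq_or_lt with rfl | hlt
      · rw [psiStar_of_mem (Or.inl rfl)]; simp
      · have h1 : i ∉ (S.fill j).1 := by
          rintro (h | h)
          · omega
          · exact hi h
        have h2 : j ∉ (S.fill i).1 := by
          rintro (h | h)
          · omega
          · exact hj h
        rw [psiStar_of_notMem h1, psiStar_of_notMem h2, S.above_fill_of_lt hj hlt,
          S.above_fill_of_le hlt.le]
        have h3 : (S.fill j).fill i = (S.fill i).fill j :=
          Subtype.ext (Set.insert_comm _ _ _)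
        rw [h3, smul_smul, smul_smul, ← add_smul, neg_one_pow_add_one]
        ring_nf
        simp

/-- Clifford relation `[ψ_i, ψ_j]_+ = 0`. -/
theorem psi_anticomm (i j : ℤ) : psi (K := K) i * psi j + psi j * psi i = 0 := by
  wlog hij : i ≤ j generalizing i j
  · rw [add_comm]; exact this j i (by omega)
  apply end_ext
  intro S
  simp only [LinearMap.add_apply, Module.End.mul_apply, LinearMap.zero_apply]
  by_cases hi : i ∈ S.1
  · by_cases hj : j ∈ S.1
    · rw [psi_of_mem hi, psi_of_mem hj, map_smul, map_smul]
      rcases hij.eq_or_lt with rfl | hlt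
      · rw [psi_of_notMem (fun h => ((S.mem_clear _ _).1 h).2 rfl)]; simp
      · have h1 : i ∈ (S.clear j).1 := ⟨hi, fun h => hlt.ne h⟩
        have h2 : j ∈ (S.clear i).1 := ⟨hj, fun h => hlt.ne' h⟩
        rw [psi_of_mem h1, psi_of_mem h2, ← S.above_clear_of_lt hj hlt,
          S.above_clear_of_le hi hlt.le]
        have h3 : (S.clear j).clear i = (S.clear i).clear j :=
          Subtype.ext (Set.sdiff_sdiff_comm)
        rw [h3, smul_smul, smul_smul, ← add_smul, neg_one_pow_add_one]
        ring_nf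
        simp
    · rw [psi_of_notMem hj, map_zero, psi_of_mem hi, map_smul,
        psi_of_notMem (fun h => hj ((S.mem_clear _ _).1 h).1), smul_zero, add_zero]
  · rw [psi_of_notMem hi, map_zero, add_zero]
    by_cases hj : j ∈ S.1
    · rw [psi_of_mem hj, map_smul, psi_of_notMem (fun h => hi ((S.mem_clear _ _).1 h).1), smul_zero]
    · rw [psi_of_notMem hj, map_zero]

/-- Clifford relation `[ψ_i, ψ*_j]_+ = δ_{ij}`. -/
theorem psi_psiStar_anticomm (i j : ℤ) :
    psi (K := K) i * psiStar j + psiStar j * psi i = if i = j then 1 else 0 := by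
  apply end_ext
  intro S
  simp only [LinearMap.add_apply, Module.End.mul_apply]
  by_cases hij : i = j
  · subst hij
    rw [if_pos rfl, Module.End.one_apply]
    by_cases hi : i ∈ S.1
    · rw [psiStar_of_mem hi, map_zero, zero_add, psi_of_mem hi, map_smul,
        psiStar_of_notMem (fun h => ((S.mem_clear _ _).1 h).2 rfl), S.fill_clear hi, S.above_clear_of_le hi le_rfl,
        smul_smul, ← mul_pow]
      simp
    · rw [psi_of_notMem hi, map_zero, add_zero, psiStar_of_notMem hi, map_smul,
        psi_of_mem (Or.inl rfl), S.clear_fill hi, S.above_fill_of_le le_rfl,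
        smul_smul, ← mul_pow]
      simp
  · rw [if_neg hij, LinearMap.zero_apply]
    by_cases hj : j ∈ S.1
    · rw [psiStar_of_mem hj, map_zero, zero_add]
      by_cases hi : i ∈ S.1
      · rw [psi_of_mem hi, map_smul, psiStar_of_mem ((S.mem_clear _ _).2 ⟨hj, fun h => hij h.symm⟩), smul_zero]
      · rw [psi_of_notMem hi, map_zero]
    · rw [psiStar_of_notMem hj, map_smul]
      by_cases hi : i ∈ S.1
      · rw [psi_of_mem (Or.inr hi), psi_of_mem hi, map_smul,
          psiStar_of_notMem (fun h => hj ((S.mem_clear _ _).1 h).1)]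
        have h3 : (S.fill j).clear i = (S.clear i).fill j := by
          apply Subtype.ext
          ext k
          simp only [Maya.fill, Maya.clear, Set.mem_sdiff, Set.mem_insert_iff,
            Set.mem_singleton_iff]
          constructor
          · rintro ⟨h | h, h'⟩
            · exact Or.inl h
            · exact Or.inr ⟨h, h'⟩
          · rintro (h | ⟨h, h'⟩)
            · exact ⟨Or.inl h, fun h' => hij (h'.symm.trans h)⟩
            · exact ⟨Or.inr h, h'⟩
        rw [h3, smul_smul, smul_smul, ← add_smul]
        rcases lt_or_gt_of_ne hij with h | h
        · rw [S.above_fill_of_lt hj h, S.above_clear_of_le hi h.le, neg_one_pow_add_one]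
          ring_nf
          simp
        · rw [S.above_fill_of_le h.le, ← S.above_clear_of_lt hi h, neg_one_pow_add_one]
          ring_nf
          simp
      · have h1 : i ∉ (S.fill j).1 := by
          rintro (h | h)
          · exact hij h
          · exact hi h
        rw [psi_of_notMem h1, psi_of_notMem hi, map_zero, smul_zero, add_zero]

/-- `ψ_i |0⟩ = 0` for positive positions. -/
theorem psi_vacuum {k : ℤ} (h : 0 < k) : psi k (vacuum : Fock K) = 0 :=
  psi_of_notMem (not_le.mpr h)

/-- `ψ*_i |0⟩ = 0` for negative positions. -/
theorem psiStar_vacuum {k : ℤ} (h : k ≤ 0) : psiStar k (vacuum : Fock K) = 0 :=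
  psiStar_of_mem h

theorem fock_induction {p : Fock K → Prop} (h0 : p 0)
    (hadd : ∀ v w, p v → p w → p (v + w)) (hs : ∀ (S : Maya) (c : K), p (c • Finsupp.single S 1))
    (v : Fock K) : p v := by
  refine Finsupp.induction_linear v h0 hadd fun S c => ?_
  have := hs S c
  rwa [Finsupp.smul_single, smul_eq_mul, mul_one] at this

/-- `⟨0| ψ_i = 0` for negative positions. -/
theorem vev_psi_mul {k : ℤ} (h : k ≤ 0) (a : Module.End K (Fock K)) : vev (psi k * a) = 0 := by
  unfold vev
  rw [Module.End.mul_apply]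
  refine fock_induction (p := fun v => psi k v Maya.vac = 0) (by simp)
    (fun v w hv hw => by simp [hv, hw]) (fun S c => ?_) (a vacuum)
  by_cases hk : k ∈ S.1
  · have : S.clear k ≠ Maya.vac := by
      intro he
      have h1 : k ∈ (S.clear k).1 := by rw [he]; exact h
      exact h1.2 rfl
    rw [map_smul, psi_of_mem hk]
    simp [this]
  · rw [map_smul, psi_of_notMem hk]
    simp

/-- `⟨0| ψ*_i = 0` for positive positions. -/
theorem vev_psiStar_mul {k : ℤ} (h : 0 < k) (a : Module.End K (Fock K)) :
    vev (psiStar k * a) = 0 := by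
  unfold vev
  rw [Module.End.mul_apply]
  refine fock_induction (p := fun v => psiStar k v Maya.vac = 0) (by simp)
    (fun v w hv hw => by simp [hv, hw]) (fun S c => ?_) (a vacuum)
  by_cases hk : k ∈ S.1
  · rw [map_smul, psiStar_of_mem hk]
    simp
  · have : S.fill k ≠ Maya.vac := by
      intro he
      have h1 : k ∈ (S.fill k).1 := Or.inl rfl
      rw [he] at h1
      exact absurd (show k ≤ 0 from h1) (not_le.mpr h)
    rw [map_smul, psiStar_of_notMem hk]
    simp [this]

/-- `⟨0|0⟩ = 1`. -/
theorem vev_one : vev (1 : Module.End K (Fock K)) = 1 := by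
  simp [vev, vacuum]

end Facts

section Hamiltonians

/-- The normal ordering `:ψ*_{i-1/2} ψ_{j-1/2}:`. -/
noncomputable def normalPair {K : Type*} [Field K] (i j : ℤ) : Module.End K (Fock K) :=
  if 0 < i then psiStar i * psi j else -(psi j * psiStar i)

/-- The operator `J_n = ∑_i :ψ*_{i-n} ψ_i:`, an infinite sum of which only finitely many terms act
nontrivially on any given basis vector (see `finite_support_J`). -/
noncomputable def J {K : Type*} [Field K] (n : ℤ) : Module.End K (Fock K) :=
  Finsupp.linearCombination K fun S : Maya =>
    ∑ᶠ i : ℤ, normalPair (i - n) i (Finsupp.single S (1 : K))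

theorem finite_support_J {K : Type*} [Field K] (n : ℤ) (S : Maya) :
    (Function.support fun i : ℤ =>
      normalPair (K := K) (i - n) i (Finsupp.single S 1)).Finite := by
  refine ((S.2.1.union (Set.finite_Ioc n 0)).union
    (S.2.2.preimage ((sub_left_injective (b := n)).injOn))).subset ?_
  intro i hi
  rw [Function.mem_support] at hi
  unfold normalPair at hi
  split_ifs at hi with h
  · left
    have hS : i ∈ S.1 := by
      by_contra hS
      exact hi (by rw [Module.End.mul_apply, psi_of_notMem hS, map_zero])
    by_cases h0 : 0 < i
    · exact Or.inl ⟨hS, h0⟩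
    · exact Or.inr ⟨by omega, not_lt.mp h0⟩
  · right
    refine ⟨fun hS => hi ?_, not_lt.mp h⟩
    rw [LinearMap.neg_apply, Module.End.mul_apply, psiStar_of_mem hS, map_zero, neg_zero]

/-! Formal infinite sums of operators are kept as power series over the endomorphism ring of Fock
space.  The series variable only records the degree by which a `J_{±q}` moves particles; it is set
to `1` when a bra-ket is evaluated. -/

/-- The Hamiltonian `φ_+(x;t) = ∑_{q ≥ 1} (1/q) (1 - (-t)^q) x^q J_q`. -/
noncomputable def phiPlus {K : Type*} [Field K] (x t : K) : PowerSeries (Module.End K (Fock K)) :=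
  PowerSeries.mk fun q : ℕ =>
    if q = 0 then 0 else (1 / (q : K) * (1 - (-t) ^ q) * x ^ q) • J (q : ℤ)

/-- The Hamiltonian `φ_-(x;t) = ∑_{q ≥ 1} (1/q) (1 - (-t)^q) x^{-q} J_{-q}`. -/
noncomputable def phiMinus {K : Type*} [Field K] (x t : K) : PowerSeries (Module.End K (Fock K)) :=
  PowerSeries.mk fun q : ℕ =>
    if q = 0 then 0 else (1 / (q : K) * (1 - (-t) ^ q) * x ^ (-(q : ℤ))) • J (-(q : ℤ))

/-- The exponential `∑_k φ^k / k!` of a series `φ` without constant term; only the `φ^k` with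
`k ≤ N` have a term of degree `N`. -/
noncomputable def opExp {K : Type*} [Field K] (φ : PowerSeries (Module.End K (Fock K))) :
    PowerSeries (Module.End K (Fock K)) :=
  PowerSeries.mk fun N : ℕ =>
    ∑ k ∈ Finset.range (N + 1), (1 / (k.factorial : K)) • PowerSeries.coeff N (φ ^ k)

/-- The bra-ket `⟨μ| X |ν⟩`, where
`|ν⟩ = ψ*_{ν₁-1/2} ⋯ ψ*_{ν_r-1/2} |0⟩` and `⟨μ| = ⟨0| ψ_{μ_s-1/2} ⋯ ψ_{μ₁-1/2}`.
For a polynomial in the fermions times one `e^{φ_±}` only finitely many degrees `N`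
contribute: each `J_{±q}` changes the sum of the particle positions by `∓q`. -/
noncomputable def braket {K : Type*} [Field K] (μ : List ℕ)
    (X : PowerSeries (Module.End K (Fock K))) (ν : List ℕ) : K :=
  ∑ᶠ N : ℕ, vev ((μ.reverse.map fun m => psi (m : ℤ)).prod * PowerSeries.coeff N X *
    (ν.map fun m => psiStar (m : ℤ)).prod)

end Hamiltonians

/-! ## Non-nested bent ice -/

/-- Orientation of a horizontal edge. -/
inductive Horiz : Type
  | left
  | right
  deriving DecidableEq

/-- Orientation of a vertical edge. -/
inductive Vert : Type
  | up
  | down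
  deriving DecidableEq

/-- The number of the edges west, north, east, south of a vertex that point towards it. -/
def inDegree (w : Horiz) (n : Vert) (e : Horiz) (s : Vert) : ℕ :=
  (if w = .right then 1 else 0) + (if n = .down then 1 else 0) +
    (if e = .left then 1 else 0) + (if s = .up then 1 else 0)

/-- The number of the edges west, north, east, south of a vertex that point away from it. -/
def outDegree (w : Horiz) (n : Vert) (e : Horiz) (s : Vert) : ℕ :=
  (if w = .left then 1 else 0) + (if n = .up then 1 else 0) +
    (if e = .right then 1 else 0) + (if s = .down then 1 else 0)

/-- The `Δ` weight with parameters `x, t` of a vertex with edges west, north, east, south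
(`0` on the ten unbalanced configurations, which never occur). -/
def weightDelta {K : Type*} [Field K] (x t : K) : Horiz → Vert → Horiz → Vert → K
  | .right, .down, .right, .down => 1
  | .left, .up, .left, .up => t * x
  | .right, .up, .right, .up => 1
  | .left, .down, .left, .down => x
  | .left, .down, .right, .up => x * (t + 1)
  | .right, .up, .left, .down => 1
  | _, _, _, _ => 0

/-- The `Γ` weight with parameters `x, t` of a vertex with edges west, north, east, south
(`0` on the ten unbalanced configurations, which never occur). -/
def weightGamma {K : Type*} [Field K] (x t : K) : Horiz → Vert → Horiz → Vert → K
  | .right, .down, .right, .down => 1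
  | .left, .up, .left, .up => x
  | .right, .up, .right, .up => t
  | .left, .down, .left, .down => x
  | .left, .down, .right, .up => x * (t + 1)
  | .right, .up, .left, .down => 1
  | _, _, _, _ => 0

/-- A state of the non-nested bent ice with top boundary `lam 0 > lam 1 > ⋯ > lam (n-1)`.

The rows are `n, n̄, …, 1, 1̄` from top to bottom; `i : Fin n` stands for the pair of rows
numbered `i + 1` and its bar.  The columns are `lam 0, …, 1` from left to right; `c : Fin (lam 0)`
stands for column `c + 1`.  In every row the horizontal edge `c.succ` is west of the vertex in
column `c + 1` and the edge `c.castSucc` is east of it; so `Fin.last` is the left boundary edge and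
`0` is the edge that enters the bend. -/
structure BentIce {n : ℕ} [NeZero n] (lam : Fin n → ℕ) where
  /-- `outer m` (for `m ≥ 1`) are the vertical edges north of row `m`; for `m < n` these are the
  edges south of row `m + 1` bar, and `outer 0` is the bottom boundary. -/
  outer : Fin (n + 1) → Fin (lam 0) → Vert
  /-- `inner i` are the vertical edges between row `i + 1` and its bar. -/
  inner : Fin n → Fin (lam 0) → Vert
  /-- The horizontal edges of row `i + 1`. -/
  horiz : Fin n → Fin (lam 0 + 1) → Horiz
  /-- The horizontal edges of row `i + 1` bar. -/
  horizBar : Fin n → Fin (lam 0 + 1) → Horiz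
  balanced : ∀ i c,
    inDegree (horiz i c.succ) (outer i.succ c) (horiz i c.castSucc) (inner i c) =
      outDegree (horiz i c.succ) (outer i.succ c) (horiz i c.castSucc) (inner i c)
  balancedBar : ∀ i c,
    inDegree (horizBar i c.succ) (inner i c) (horizBar i c.castSucc) (outer i.castSucc c) =
      outDegree (horizBar i c.succ) (inner i c) (horizBar i c.castSucc) (outer i.castSucc c)
  /-- The bend joins the right ends of the two rows: one of them flows out, the other in. -/
  bend : ∀ i, horiz i 0 ≠ horizBar i 0
  left_boundary : ∀ i, horiz i (Fin.last _) = .right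
  left_boundaryBar : ∀ i, horizBar i (Fin.last _) = .right
  bottom_boundary : ∀ c, outer 0 c = .down
  top_boundary : ∀ c, outer (Fin.last n) c = .up ↔ ∃ j, lam j = (c : ℕ) + 1

/-- The strictly decreasing list of the column numbers at which a row of vertical edges
points up. -/
def upColumns {L : ℕ} (v : Fin L → Vert) : List ℕ :=
  (((Finset.univ.filter fun c => v c = .up).image fun c : Fin L => (c : ℕ) + 1).sort (· ≥ ·))

namespace BentIce

variable {n : ℕ} [NeZero n] {lam : Fin n → ℕ}

/-- The partition `λ^{(m)}` for `0 ≤ m ≤ n`: the columns whose vertex in row `m` has its northern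
edge up; `λ^{(0)}`, read off from the bottom boundary, is empty. -/
def part (A : BentIce lam) (m : Fin (n + 1)) : List ℕ := upColumns (A.outer m)

/-- The partition `λ^{(ī)}` of the row numbered `i + 1` bar. -/
def partBar (A : BentIce lam) (i : Fin n) : List ℕ := upColumns (A.inner i)

/-- The `ΔΓ'` weight of the double row numbered `i + 1`: `Δ` weights with parameters `x_i, t` in
the upper row, `Γ` weights with parameters `x_i⁻¹, t` in the lower row, and weight `t x_i` for an
upward bend (flow from the lower row into the upper row), `x_i⁻¹` for a downward bend. -/
def rowWeight {K : Type*} [Field K] (A : BentIce lam) (x : Fin n → K) (t : K) (i : Fin n) : K :=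
  (∏ c : Fin (lam 0), weightDelta (x i) t
      (A.horiz i c.succ) (A.outer i.succ c) (A.horiz i c.castSucc) (A.inner i c)) *
    (∏ c : Fin (lam 0), weightGamma (x i)⁻¹ t
      (A.horizBar i c.succ) (A.inner i c) (A.horizBar i c.castSucc) (A.outer i.castSucc c)) *
    (if A.horiz i 0 = .left then t * x i else (x i)⁻¹)

end BentIce

end SixVertex

namespace SixVertex

/-! ## Ring structure on the operators

Both instances keep the additive monoid and the semiring of `Finsupp` and `Module.End`
syntactically, which unification needs in order to apply ring lemmas to `psi` and `psiStar`. -/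

/-! A row of `Δ` ice is read as a motion of fermions: up arrows north of the row are particles
before the motion, up arrows south of it are particles after it, and a horizontal edge pointing left
is a particle in flight. Since `[J_q, ψ*_k] = ψ*_{k-q}` and `∑ (1 - (-t)^q) x^q z^q / q = log ((1 +
txz)/(1 - xz))`, conjugation by `e^{φ_+}` turns `ψ*_k` into `ψ*_k + ∑_{q ≥ 1} (1 + t) x^q z^q
ψ*_{k-q}`: a particle stays, or hops down by `q` with weight `(1 + t) x^q`
(`opExp_phiPlus_mul_psiStar`).

These hop weights are geometric, so a hop can be followed column by column from the left: at each
column the particle lands or pays `x` and goes on. Anticommutation accounts for a flight over a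
resident particle, with weight `tx`. Peeling off the leftmost column gives exactly the six `Δ`
weights (`sumsTo_row`). At the right end, a flight leaving the lattice can only fill the hole made
by `ψ_{-1/2}`, so `α₁` selects the edge pointing left and `α₂` the edge pointing right
(`braket_phiPlus_eq`).

The lower row reduces to the same computation. Transposition turns `φ_-` into `φ_+` and exchanges
bra and ket (`braket_phiMinus_eq`). On the ice side, reversing horizontal arrows and exchanging
north with south turns `Γ` weights at `x⁻¹` into `Δ` weights at `x`, up to powers of `x` and a gauge
factor that telescopes (`prod_weightGamma_inv`). The operator `ψ_{λ₁+1/2}` becomes one extra column,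
which repairs the reversed left boundary.

Moving `ψ_{-1/2}` through a ket gives a sign depending on its number of particles, which flux
conservation determines (`BentIce.length_part`). With the given constants the lower bra-ket is the
product of the `Γ` weights, and the upper one the product of the `Δ` weights and the bend. -/

noncomputable instance fockAddCommGroup {K : Type*} [Field K] : AddCommGroup (Fock K) where
  toAddMonoid := Finsupp.instAddCommMonoid.toAddMonoid
  neg v := -v
  zsmul n v := n • v
  sub v w := v - w
  sub_eq_add_neg := sub_eq_add_neg
  zsmul_zero' := SubNegMonoid.zsmul_zero'
  zsmul_succ' := SubNegMonoid.zsmul_succ'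
  zsmul_neg' := SubNegMonoid.zsmul_neg'
  neg_add_cancel := neg_add_cancel
  add_comm := add_comm

noncomputable instance endFockRing {K : Type*} [Field K] : Ring (Module.End K (Fock K)) where
  toSemiring := Module.End.instSemiring
  neg a := -a
  zsmul n a := n • a
  sub a b := a - b
  sub_eq_add_neg := sub_eq_add_neg
  zsmul_zero' := SubNegMonoid.zsmul_zero'
  zsmul_succ' := SubNegMonoid.zsmul_succ'
  zsmul_neg' := SubNegMonoid.zsmul_neg'
  neg_add_cancel := neg_add_cancel
  intCast z := z • (1 : Module.End K (Fock K))
  intCast_ofNat := natCast_zsmul _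
  intCast_negSucc := negSucc_zsmul _

/-! ### Commutators of the currents `J` with the fermions. -/

section Commutators

variable {K : Type*} [Field K]

theorem psiStar_mul_psiStar (i j : ℤ) :
    psiStar (K := K) i * psiStar j = -(psiStar j * psiStar i) :=
  eq_neg_of_add_eq_zero_left (psiStar_anticomm i j)

theorem psi_mul_psi (i j : ℤ) : psi (K := K) i * psi j = -(psi j * psi i) :=
  eq_neg_of_add_eq_zero_left (psi_anticomm i j)

theorem psi_mul_psiStar {i j : ℤ} (h : i ≠ j) :
    psi (K := K) i * psiStar j = -(psiStar j * psi i) :=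
  eq_neg_of_add_eq_zero_left (by rw [psi_psiStar_anticomm, if_neg h])

theorem psiStar_mul_psi {i j : ℤ} (h : i ≠ j) :
    psiStar (K := K) i * psi j = -(psi j * psiStar i) := by
  rw [psi_mul_psiStar h.symm, neg_neg]

theorem psi_mul_psiStar_self (i : ℤ) :
    psi (K := K) i * psiStar i = 1 - psiStar i * psi i :=
  eq_sub_of_add_eq (by rw [psi_psiStar_anticomm, if_pos rfl])

theorem psiStar_mul_psiStar_self (i : ℤ) : psiStar (K := K) i * psiStar i = 0 := by
  refine end_ext fun S => ?_
  rw [Module.End.mul_apply]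
  by_cases hi : i ∈ S.1
  · rw [psiStar_of_mem hi, map_zero, LinearMap.zero_apply]
  · rw [psiStar_of_notMem hi, map_smul, psiStar_of_mem (Or.inl rfl), smul_zero,
      LinearMap.zero_apply]

theorem normalPair_of_ne {i j : ℤ} (h : i ≠ j) :
    normalPair (K := K) i j = psiStar i * psi j := by
  unfold normalPair
  rw [← psiStar_mul_psi h, ite_self]

theorem finite_support_normalPair (n : ℤ) (v : Fock K) :
    (Function.support fun i : ℤ => normalPair (K := K) (i - n) i v).Finite := by
  refine fock_induction (p := fun v => (Function.support fun i : ℤ =>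
    normalPair (K := K) (i - n) i v).Finite) (by simp) (fun v w hv hw => ?_) (fun S c => ?_) v
  · refine (hv.union hw).subset ?_
    simp only [map_add]
    exact Function.support_add _ _
  · refine (finite_support_J (K := K) n S).subset ?_
    simp only [map_smul]
    exact Function.support_const_smul_subset c _

theorem J_apply (n : ℤ) (v : Fock K) : J n v = ∑ᶠ i : ℤ, normalPair (i - n) i v := by
  refine fock_induction (p := fun v => J n v = ∑ᶠ i : ℤ, normalPair (i - n) i v) (by simp)
    (fun v w hv hw => ?_) (fun S c => ?_) v
  · simp only [map_add, hv, hw]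
    exact (finsum_add_distrib (finite_support_normalPair n v) (finite_support_normalPair n w)).symm
  · simp only [map_smul]
    rw [← smul_finsum]
    simp [J, Finsupp.linearCombination_single]

/-- Normal ordering changes `ψ*_i ψ_j` only by a scalar, which commutes with everything, so the
commutator is that of the unordered product. -/
theorem normalPair_mul_psiStar (i j k : ℤ) :
    normalPair (K := K) i j * psiStar k =
      psiStar k * normalPair i j + if j = k then psiStar i else 0 := by
  have key : psiStar (K := K) i * psi j * psiStar k =
      psiStar k * (psiStar i * psi j) + if j = k then psiStar i else 0 := by
    have h := psi_psiStar_anticomm (K := K) j k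
    rw [mul_assoc, eq_sub_of_add_eq h, mul_sub, ← mul_assoc, psiStar_mul_psiStar i k]
    split_ifs <;> simp [mul_assoc, add_comm]
  unfold normalPair
  by_cases h0 : 0 < i
  · rw [if_pos h0, key]
  · have h' := psi_psiStar_anticomm (K := K) j i
    rw [if_neg h0, eq_sub_of_add_eq h', neg_sub, sub_mul, key, mul_sub]
    by_cases h : j = i <;> simp [h]; abel

/-- The commutator `[J_n, ψ*_k] = ψ*_{k-n}`. -/
theorem J_mul_psiStar (n k : ℤ) :
    J (K := K) n * psiStar k = psiStar k * J n + psiStar (k - n) := by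
  refine LinearMap.ext fun v => ?_
  simp only [Module.End.mul_apply, LinearMap.add_apply, J_apply]
  have hterm : ∀ i : ℤ, normalPair (i - n) i (psiStar k v) =
      psiStar k (normalPair (i - n) i v) + if i = k then psiStar (k - n) v else 0 := by
    intro i
    have := congrArg (fun a : Module.End K (Fock K) => a v) (normalPair_mul_psiStar (i - n) i k)
    simp only [Module.End.mul_apply, LinearMap.add_apply] at this
    rw [this]
    split_ifs with h
    · rw [h]
    · rfl
  have h1 : (Function.support fun i : ℤ => psiStar k (normalPair (i - n) i v)).Finite :=
    (finite_support_normalPair n v).subset fun i hi h0 => hi (by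
      simp only [h0, map_zero])
  have h2 : (Function.support fun i : ℤ => if i = k then psiStar (k - n) v else 0).Finite :=
    (Set.finite_singleton k).subset fun i hi => by
      by_contra h
      exact hi (if_neg h)
  rw [finsum_congr hterm, finsum_add_distrib h1 h2]
  congr 1
  · exact ((psiStar k).toAddMonoidHom.map_finsum (finite_support_normalPair n v)).symm
  · rw [finsum_eq_single _ k fun i hi => if_neg hi, if_pos rfl]

theorem J_vacuum {n : ℤ} (hn : 0 < n) : J n (vacuum : Fock K) = 0 := by
  rw [J_apply]
  refine finsum_eq_zero_of_forall_eq_zero fun i => ?_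
  unfold normalPair
  split_ifs with h
  · rw [Module.End.mul_apply, psi_vacuum (by omega), map_zero]
  · rw [LinearMap.neg_apply, Module.End.mul_apply, psiStar_vacuum (by omega), map_zero, neg_zero]

/-- Removing the topmost particle of the vacuum leaves a shifted vacuum: every position below an
occupied one is occupied, so no particle can be lowered. -/
theorem J_psi_zero_vacuum {n : ℤ} (hn : 0 < n) : J n (psi 0 (vacuum : Fock K)) = 0 := by
  rw [J_apply]
  refine finsum_eq_zero_of_forall_eq_zero fun i => ?_
  rw [normalPair_of_ne (by omega), ← Module.End.mul_apply, mul_assoc, psi_mul_psi]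
  by_cases h : 0 < i
  · simp [psi_vacuum h]
  · have h1 : psiStar (K := K) (i - n) * (psi 0 * psi i) = psi 0 * psi i * psiStar (i - n) := by
      rw [← mul_assoc, psiStar_mul_psi (by omega), neg_mul, mul_assoc,
        psiStar_mul_psi (by omega), mul_neg, neg_neg, mul_assoc]
    rw [mul_neg, h1, LinearMap.neg_apply, Module.End.mul_apply, psiStar_vacuum (by omega), map_zero,
      neg_zero]

end Commutators

/-! ### Conjugation of `ψ*` by the exponential of `φ_+`. -/

section Exponential

variable {K : Type*} [Field K]

open PowerSeries

theorem coeff_smul_apply {A : Type*} [Semiring A] [Module K A] (c : K) (F : A⟦X⟧) (N : ℕ) :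
    coeff N (c • F) = c • coeff N F := rfl

/-- The scalar series `∑_{q ≥ 1} (1/q) (1 - (-t)^q) x^q z^q` of the coefficients of `φ_+`. -/
noncomputable def phiScalar (x t : K) : K⟦X⟧ :=
  mk fun q : ℕ => if q = 0 then 0 else 1 / (q : K) * (1 - (-t) ^ q) * x ^ q

/-- The partial sums `∑_{k ≤ M} a^k / k!` of the exponential. -/
noncomputable def expTrunc {A : Type*} [Ring A] [Algebra K A] (M : ℕ) (a : A) : A :=
  ∑ k ∈ Finset.range (M + 1), (1 / (k.factorial : K)) • a ^ k

/-- The exponential of a scalar series without constant term. -/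
noncomputable def scalarExp (a : K⟦X⟧) : K⟦X⟧ :=
  mk fun N => ∑ k ∈ Finset.range (N + 1), 1 / (k.factorial : K) * coeff N (a ^ k)

/-- The series `(1 + t x z) / (1 - x z)`. -/
noncomputable def hopSeries (x t : K) : K⟦X⟧ :=
  mk fun q : ℕ => if q = 0 then 1 else (1 + t) * x ^ q

theorem coeff_pow_of_lt {A : Type*} [Ring A] {a : A⟦X⟧} (ha : coeff 0 a = 0) {N k : ℕ}
    (h : N < k) : coeff N (a ^ k) = 0 := by
  obtain ⟨b, rfl⟩ := X_dvd_iff.2 (by rwa [← coeff_zero_eq_constantCoeff_apply] : constantCoeff a = 0)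
  rw [(commute_X b).symm.mul_pow, coeff_X_pow_mul', if_neg (by omega)]

/-- The cutoff in `opExp` and `scalarExp` varies with the degree. One fixed cutoff makes the
exponential a polynomial in `a`, open to derivations and ring identities. -/
theorem sum_pow_coeff_eq {A : Type*} [Ring A] [Algebra K A] {a : A⟦X⟧} (ha : coeff 0 a = 0)
    {N M : ℕ} (h : N ≤ M) :
    ∑ k ∈ Finset.range (N + 1), (1 / (k.factorial : K)) • coeff N (a ^ k) =
      coeff N (expTrunc (K := K) M a) := by
  unfold expTrunc
  rw [map_sum]
  refine Finset.sum_subset (Finset.range_mono (by omega)) fun k _ hk => ?_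
  rw [coeff_pow_of_lt ha (by simpa using hk), smul_zero]

theorem coeff_scalarExp {a : K⟦X⟧} (ha : coeff 0 a = 0) {N M : ℕ} (h : N ≤ M) :
    coeff N (scalarExp a) = coeff N (expTrunc (K := K) M a) := by
  rw [← sum_pow_coeff_eq ha h, scalarExp, coeff_mk]
  rfl

theorem coeff_opExp {φ : PowerSeries (Module.End K (Fock K))} (hφ : coeff 0 φ = 0) {N M : ℕ}
    (h : N ≤ M) : coeff N (opExp φ) = coeff N (expTrunc (K := K) M φ) := by
  rw [← sum_pow_coeff_eq hφ h, opExp, coeff_mk]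

theorem coeff_mul_congr {A : Type*} [Semiring A] {N : ℕ} {a a' b b' : A⟦X⟧}
    (ha : ∀ n ≤ N, coeff n a = coeff n a') (hb : ∀ n ≤ N, coeff n b = coeff n b') :
    coeff N (a * b) = coeff N (a' * b') := by
  rw [coeff_mul, coeff_mul]
  refine Finset.sum_congr rfl fun p hp => ?_
  have := Finset.HasAntidiagonal.mem_antidiagonal.1 hp
  rw [ha _ (by omega), hb _ (by omega)]

/-- This is the differential equation `F' = a' F` in coefficients, for `F = (1 + txz)/(1 - xz)` and
`a = log F`. -/
theorem hopSeries_recursion (x t : K) (n : ℕ) :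
    ∑ p ∈ Finset.range (n + 1), (1 - (-t) ^ (p + 1)) * x ^ (p + 1) * coeff (n - p) (hopSeries x t) =
      (n + 1) * coeff (n + 1) (hopSeries x t) := by
  have h1 : ∀ p ∈ Finset.range n,
      (1 - (-t) ^ (p + 1)) * x ^ (p + 1) * coeff (n - p) (hopSeries x t) =
        (1 + t) * (1 - (-t) ^ (p + 1)) * x ^ (n + 1) := by
    intro p hp
    have hp' := Finset.mem_range.1 hp
    rw [hopSeries, coeff_mk, if_neg (by omega),
      show n + 1 = (p + 1) + (n - p) by omega, pow_add x (p + 1)]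
    ring
  have h2 : ∀ m : ℕ, ∑ p ∈ Finset.range m, (1 + t) * (1 - (-t) ^ (p + 1)) =
      (m + 1) * (1 + t) - (1 - (-t) ^ (m + 1)) := by
    intro m
    induction m with
    | zero => simp
    | succ m ih => rw [Finset.sum_range_succ, ih]; push_cast; ring
  rw [Finset.sum_range_succ, Finset.sum_congr rfl h1, ← Finset.sum_mul, h2]
  simp only [hopSeries, coeff_mk, Nat.sub_self, if_true, Nat.succ_ne_zero, if_false]
  ring

theorem coeff_zero_phiScalar (x t : K) : coeff 0 (phiScalar x t) = 0 := by simp [phiScalar]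

theorem derivative_expTrunc [CharZero K] (a : K⟦X⟧) (M : ℕ) :
    d⁄dX K (expTrunc (K := K) (M + 1) a) = d⁄dX K a * expTrunc (K := K) M a := by
  unfold expTrunc
  rw [Finset.sum_range_succ', map_add, map_sum, Finset.mul_sum, pow_zero, Derivation.map_smul,
    Derivation.map_one_eq_zero, smul_zero, add_zero]
  refine Finset.sum_congr rfl fun k _ => ?_
  rw [Derivation.map_smul, derivative_pow, Nat.factorial_succ, Nat.add_sub_cancel, mul_smul_comm]
  have hk : (k : K) + 1 ≠ 0 := by exact_mod_cast k.succ_ne_zero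
  have hf : (k.factorial : K) ≠ 0 := by exact_mod_cast k.factorial_ne_zero
  have : ((k + 1 : ℕ) : K⟦X⟧) = C ((k : K) + 1) := by simp
  rw [this, mul_assoc, ← smul_eq_C_mul, smul_smul, mul_comm (a ^ k)]
  congr 1
  push_cast
  field_simp

/-- Both sides solve `F' = a' F` with `F(0) = 1`; in characteristic zero this fixes the coefficients
recursively. -/
theorem scalarExp_phiScalar [CharZero K] (x t : K) :
    scalarExp (phiScalar x t) = hopSeries x t := by
  have ha := coeff_zero_phiScalar x t
  ext N
  induction N using Nat.strong_induction_on with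
  | _ N ih =>
    cases N with
    | zero => simp [scalarExp, hopSeries]
    | succ n =>
      have hn : (n : K) + 1 ≠ 0 := by exact_mod_cast n.succ_ne_zero
      refine mul_left_cancel₀ hn ?_
      rw [← hopSeries_recursion, coeff_scalarExp ha le_rfl, mul_comm, ← coeff_derivative,
        derivative_expTrunc, coeff_mul, Finset.Nat.sum_antidiagonal_eq_sum_range_succ_mk]
      refine Finset.sum_congr rfl fun p hp => ?_
      have hp' := Finset.mem_range.1 hp
      rw [← coeff_scalarExp ha (by omega : n - p ≤ n), ih _ (by omega), coeff_derivative, phiScalar,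
        coeff_mk, if_neg (by omega)]
      have : (p : K) + 1 ≠ 0 := by exact_mod_cast p.succ_ne_zero
      push_cast
      field_simp

/-- The series `∑_q f_q z^q ψ*_{k-q}`. -/
noncomputable def psiStarSeries (k : ℤ) : K⟦X⟧ →ₗ[K] (Module.End K (Fock K))⟦X⟧ where
  toFun f := mk fun q => coeff q f • psiStar (k - q)
  map_add' f g := by ext1 q; simp [add_smul]
  map_smul' c f := by ext1 q; simp [mul_smul]

theorem coeff_psiStarSeries (k : ℤ) (f : K⟦X⟧) (q : ℕ) :
    coeff q (psiStarSeries k f) = coeff q f • psiStar (k - q) := by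
  simp [psiStarSeries]

theorem psiStarSeries_one (k : ℤ) : psiStarSeries (K := K) k 1 = C (psiStar k) := by
  ext1 q
  rw [coeff_psiStarSeries, coeff_one, coeff_C]
  split_ifs with h <;> simp [h]

theorem coeff_phiPlus (x t : K) (q : ℕ) :
    coeff q (phiPlus x t) = coeff q (phiScalar x t) • J (q : ℤ) := by
  simp only [phiPlus, phiScalar, coeff_mk]
  split_ifs <;> simp

theorem coeff_zero_phiPlus (x t : K) : coeff 0 (phiPlus x t) = 0 := by simp [phiPlus]

/-- Because `J_q` shifts `ψ*_k` to `ψ*_{k-q}`, the commutator with `φ_+` acts on these series as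
multiplication by a scalar series. -/
theorem phiPlus_mul_psiStarSeries (x t : K) (k : ℤ) (f : K⟦X⟧) :
    phiPlus x t * psiStarSeries k f =
      psiStarSeries k f * phiPlus x t + psiStarSeries k (phiScalar x t * f) := by
  ext1 N
  rw [map_add, coeff_mul, coeff_mul, coeff_psiStarSeries, coeff_mul, Finset.sum_smul,
    ← Finset.Nat.sum_antidiagonal_swap (n := N) (f := fun p =>
      coeff p.1 (psiStarSeries k f) * coeff p.2 (phiPlus x t)), ← Finset.sum_add_distrib]
  refine Finset.sum_congr rfl fun p hp => ?_
  have hN : k - (N : ℤ) = k - p.2 - p.1 := by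
    rw [← Finset.HasAntidiagonal.mem_antidiagonal.1 hp]; push_cast; ring
  simp only [coeff_psiStarSeries, coeff_phiPlus, Prod.fst_swap, Prod.snd_swap]
  rw [smul_mul_smul_comm, smul_mul_smul_comm, J_mul_psiStar, hN, smul_add, mul_comm (coeff p.2 f)]

/-- Left multiplication by `φ` is the commutator with `φ` plus right multiplication. The two
commute, so the binomial theorem applies. -/
theorem phiPlus_pow_mul_psiStarSeries (x t : K) (k : ℤ) (m : ℕ) :
    phiPlus x t ^ m * psiStarSeries k 1 = ∑ p ∈ Finset.HasAntidiagonal.antidiagonal m,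
      (m.choose p.1 : K) • (psiStarSeries k (phiScalar x t ^ p.1) * phiPlus x t ^ p.2) := by
  set φ := phiPlus x t
  let l := LinearMap.mulLeft K φ
  let r := LinearMap.mulRight K φ
  have hc : Commute (l - r) r :=
    Commute.sub_left (LinearMap.commute_mulLeft_right φ φ) (Commute.refl r)
  have had : ∀ j : ℕ, ((l - r) ^ j) (psiStarSeries k 1) = psiStarSeries k (phiScalar x t ^ j) := by
    intro j
    induction j with
    | zero => simp
    | succ j ih =>
      rw [pow_succ', Module.End.mul_apply, ih, LinearMap.sub_apply, LinearMap.mulLeft_apply,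
        LinearMap.mulRight_apply, phiPlus_mul_psiStarSeries, add_sub_cancel_left, pow_succ']
  have h1 : (l ^ m) (psiStarSeries k 1) = φ ^ m * psiStarSeries k 1 := by
    rw [LinearMap.pow_mulLeft, LinearMap.mulLeft_apply]
  have h2 : l = (l - r) + r := by abel
  rw [← h1, h2, hc.add_pow', LinearMap.sum_apply]
  refine Finset.sum_congr rfl fun p _ => ?_
  rw [← Nat.cast_smul_eq_nsmul K, LinearMap.smul_apply, (hc.pow_pow _ _).eq, Module.End.mul_apply, had, LinearMap.pow_mulRight,
    LinearMap.mulRight_apply]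

/-- For the Cauchy product of two truncated exponentials: the square exceeds the triangle only by
terms of degree too high to matter. -/
theorem sum_range_antidiagonal_eq {M : Type*} [AddCommMonoid M] (N : ℕ) (g : ℕ → ℕ → M)
    (hg : ∀ i j, N < i + j → g i j = 0) :
    ∑ m ∈ Finset.range (N + 1), ∑ p ∈ Finset.HasAntidiagonal.antidiagonal m, g p.1 p.2 =
      ∑ i ∈ Finset.range (N + 1), ∑ j ∈ Finset.range (N + 1), g i j := by
  rw [Finset.sum_sigma', ← Finset.sum_product']
  refine Finset.sum_bij_ne_zero (fun s _ _ => s.2) ?_ ?_ ?_ ?_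
  · rintro ⟨m, p⟩ h _
    simp only [Finset.mem_sigma, Finset.mem_range, Finset.HasAntidiagonal.mem_antidiagonal,
      Finset.mem_product] at h ⊢
    omega
  · rintro ⟨m, p⟩ h _ ⟨m', p'⟩ h' _ (rfl : p = p')
    simp only [Finset.mem_sigma, Finset.HasAntidiagonal.mem_antidiagonal] at h h'
    rw [← h.2, ← h'.2]
  · intro p _ hp
    refine ⟨⟨p.1 + p.2, p⟩, ?_, hp, rfl⟩
    simp only [Finset.mem_sigma, Finset.mem_range, Finset.HasAntidiagonal.mem_antidiagonal]
    refine ⟨?_, trivial⟩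
    by_contra h
    exact hp (hg _ _ (by omega))
  · intros
    rfl

/-- This is `e^φ ψ* e^{-φ} = e^{ad φ} ψ*`, written so that no inverse of `e^φ` is needed. -/
theorem opExp_phiPlus_mul_psiStar [CharZero K] (x t : K) (k : ℤ) :
    opExp (phiPlus x t) * C (psiStar k) =
      psiStarSeries k (hopSeries x t) * opExp (phiPlus x t) := by
  have hφ := coeff_zero_phiPlus x t
  have ha := coeff_zero_phiScalar x t
  ext1 N
  rw [← psiStarSeries_one,
    coeff_mul_congr (fun n hn => coeff_opExp hφ hn) (fun n _ => rfl),
    coeff_mul_congr (b' := expTrunc (K := K) N (phiPlus x t))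
      (a' := psiStarSeries k (expTrunc (K := K) N (phiScalar x t)))
      (fun n hn => by
        rw [coeff_psiStarSeries, coeff_psiStarSeries, ← scalarExp_phiScalar, coeff_scalarExp ha hn])
      (fun n hn => coeff_opExp hφ hn)]
  unfold expTrunc
  have hterm : ∀ m ∈ Finset.range (N + 1),
      coeff N ((1 / (m.factorial : K)) • phiPlus x t ^ m * psiStarSeries k 1) =
        ∑ p ∈ Finset.HasAntidiagonal.antidiagonal m,
          coeff N (psiStarSeries k ((1 / (p.1.factorial : K)) • phiScalar x t ^ p.1) *
            (1 / (p.2.factorial : K)) • phiPlus x t ^ p.2) := by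
    intro m _
    rw [smul_mul_assoc, phiPlus_pow_mul_psiStarSeries, coeff_smul_apply, map_sum, Finset.smul_sum]
    refine Finset.sum_congr rfl fun p hp => ?_
    rw [coeff_smul_apply, LinearMap.map_smul (psiStarSeries k), smul_mul_smul_comm,
      coeff_smul_apply, smul_smul, ← Finset.HasAntidiagonal.mem_antidiagonal.1 hp, Nat.cast_add_choose]
    have h1 : (((p.1 + p.2).factorial : ℕ) : K) ≠ 0 := by exact_mod_cast Nat.factorial_ne_zero _
    congr 1
    field_simp
  rw [Finset.sum_mul, map_sum, Finset.sum_congr rfl hterm, sum_range_antidiagonal_eq N (fun i j =>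
    coeff N (psiStarSeries k ((1 / (i.factorial : K)) • phiScalar x t ^ i) *
            (1 / (j.factorial : K)) • phiPlus x t ^ j)), map_sum, Finset.sum_mul, map_sum]
  · refine Finset.sum_congr rfl fun i _ => ?_
    rw [Finset.mul_sum, map_sum]
  · intro i j hij
    rw [coeff_mul]
    refine Finset.sum_eq_zero fun p hp => ?_
    have := Finset.HasAntidiagonal.mem_antidiagonal.1 hp
    rw [coeff_psiStarSeries, coeff_smul_apply, coeff_smul_apply]
    rcases lt_or_ge p.1 i with h | h
    · rw [coeff_pow_of_lt ha h, smul_zero, zero_smul, zero_mul]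
    · rw [coeff_pow_of_lt hφ (by omega), smul_zero, mul_zero]

end Exponential

/-! ### Evaluation of series at `z = 1`, and the operator of a particle in flight. -/

section Series

variable {K : Type*} [Field K]

open PowerSeries

/-- The series `F` is a polynomial in `z` whose value at `z = 1` is `a`. -/
def SumsTo (F : K⟦X⟧) (a : K) : Prop := ∃ p : Polynomial K, (p : K⟦X⟧) = F ∧ p.eval 1 = a

namespace SumsTo

theorem zero : SumsTo (0 : K⟦X⟧) 0 := ⟨0, by simp, by simp⟩

theorem one : SumsTo (1 : K⟦X⟧) 1 := ⟨1, by simp, by simp⟩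

theorem add {F G : K⟦X⟧} {a b : K} (hF : SumsTo F a) (hG : SumsTo G b) :
    SumsTo (F + G) (a + b) := by
  obtain ⟨p, rfl, rfl⟩ := hF
  obtain ⟨q, rfl, rfl⟩ := hG
  exact ⟨p + q, by simp, by simp⟩

theorem smul (c : K) {F : K⟦X⟧} {a : K} (hF : SumsTo F a) : SumsTo (c • F) (c * a) := by
  obtain ⟨p, rfl, rfl⟩ := hF
  exact ⟨c • p, by simp, by simp⟩

theorem X_mul {F : K⟦X⟧} {a : K} (hF : SumsTo F a) : SumsTo (X * F) a := by
  obtain ⟨p, rfl, rfl⟩ := hF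
  exact ⟨Polynomial.X * p, by simp, by simp⟩

/-- A `finsum` with infinite support is zero by convention, so a bra-ket has its intended value only
because the series is a polynomial. -/
theorem finsum_coeff {F : K⟦X⟧} {a : K} (hF : SumsTo F a) : ∑ᶠ N : ℕ, coeff N F = a := by
  obtain ⟨p, rfl, rfl⟩ := hF
  simp only [Polynomial.coeff_coe]
  rw [finsum_eq_sum_of_support_subset (s := p.support) _ (fun N hN => by simpa using hN),
    Polynomial.eval_eq_sum, Polynomial.sum_def]
  simp

end SumsTo

/-- The vacuum expectation value of a series of operators, degree by degree. -/
noncomputable def vevSeries : (Module.End K (Fock K))⟦X⟧ →ₗ[K] K⟦X⟧ where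
  toFun F := mk fun N => vev (coeff N F)
  map_add' F G := by ext1 N; simp [vev]
  map_smul' c F := by ext1 N; simp [vev]

theorem coeff_vevSeries (F : (Module.End K (Fock K))⟦X⟧) (N : ℕ) :
    coeff N (vevSeries F) = vev (coeff N F) := by
  simp [vevSeries]

theorem vevSeries_X_mul (F : (Module.End K (Fock K))⟦X⟧) :
    vevSeries (X * F) = X * vevSeries F := by
  ext1 N
  cases N with
  | zero => simp [coeff_vevSeries, vev]
  | succ N => simp [coeff_vevSeries, coeff_succ_X_mul]

theorem psiStarSeries_anticomm (j k : ℤ) (f g : K⟦X⟧) :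
    psiStarSeries j f * psiStarSeries k g = -(psiStarSeries k g * psiStarSeries j f) := by
  ext1 N
  rw [map_neg, coeff_mul, coeff_mul, ← Finset.Nat.sum_antidiagonal_swap, ← Finset.sum_neg_distrib]
  refine Finset.sum_congr rfl fun p _ => ?_
  simp only [coeff_psiStarSeries, Prod.fst_swap, Prod.snd_swap]
  rw [smul_mul_smul_comm, smul_mul_smul_comm, psiStar_mul_psiStar, smul_neg,
    mul_comm (coeff p.1 g)]

theorem psiStarSeries_mul_self [CharZero K] (k : ℤ) (f : K⟦X⟧) :
    psiStarSeries k f * psiStarSeries k f = 0 := by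
  have h := psiStarSeries_anticomm k k f f
  have h2 : (2 : K) • (psiStarSeries k f * psiStarSeries k f) = 0 := by
    rw [two_smul]; nth_rewrite 1 [h]; exact neg_add_cancel _
  have := congrArg (fun F => (2⁻¹ : K) • F) h2
  simpa only [smul_smul, inv_mul_cancel₀ (two_ne_zero : (2 : K) ≠ 0), one_smul, smul_zero] using this

theorem C_psi_mul_psiStarSeries {i k : ℤ} {f : K⟦X⟧} (h : ∀ q : ℕ, k - q = i → coeff q f = 0) :
    C (psi i) * psiStarSeries k f = -(psiStarSeries k f * C (psi i)) := by
  ext1 N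
  rw [map_neg, coeff_C_mul, coeff_mul_C, coeff_psiStarSeries]
  by_cases hN : k - N = i
  · simp [h N hN]
  · rw [mul_smul_comm, psi_mul_psiStar (Ne.symm hN), smul_mul_assoc, smul_neg]

theorem psiStarSeries_X_mul (k : ℤ) (f : K⟦X⟧) :
    psiStarSeries (k + 1) (X * f) = X * psiStarSeries k f := by
  ext1 N
  cases N with
  | zero => simp [coeff_psiStarSeries]
  | succ N =>
    rw [coeff_succ_X_mul, coeff_psiStarSeries, coeff_succ_X_mul, coeff_psiStarSeries]
    congr 2
    push_cast
    ring

/-- The operator carried by a left-pointing edge whose western end is at column `c + 1`: the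
series `∑_{q ≥ 1} (1 + t) x^q z^q ψ*_{c+1-q}`. -/
noncomputable def inFlight (x t : K) (c : ℤ) : (Module.End K (Fock K))⟦X⟧ :=
  psiStarSeries (c + 1) (hopSeries x t - 1)

theorem psiStarSeries_hopSeries (x t : K) (c : ℤ) :
    psiStarSeries (c + 1) (hopSeries x t) = C (psiStar (c + 1)) + inFlight x t c := by
  rw [inFlight, map_sub, psiStarSeries_one, add_sub_cancel]

/-- The tail of a geometric series is proportional to the series: a particle reaching column `c + 1`
lands there or flies on. -/
theorem inFlight_succ (x t : K) (c : ℤ) :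
    inFlight x t (c + 1) =
      (x * (t + 1)) • (X * C (psiStar (c + 1))) + x • (X * inFlight x t c) := by
  have h : hopSeries x t - 1 = X * (x • (hopSeries x t - 1) + C (x * (t + 1))) := by
    ext N
    cases N with
    | zero => simp [hopSeries]
    | succ N =>
      rw [coeff_succ_X_mul]
      cases N with
      | zero => simp [hopSeries, coeff_one]; ring
      | succ N => simp [hopSeries, coeff_one]; ring
  have h1 : (C (x * (t + 1)) : K⟦X⟧) = (x * (t + 1)) • 1 := by
    rw [smul_eq_C_mul, mul_one]
  rw [inFlight, h, psiStarSeries_X_mul, map_add, h1, map_smul, map_smul, psiStarSeries_one, mul_add,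
    mul_smul_comm, mul_smul_comm, inFlight, add_comm]

/-- A flight starts with `q = 1`, so it never contains `ψ*_{c+1}`. -/
theorem C_psi_mul_inFlight (x t : K) (c : ℤ) :
    C (psi (c + 1)) * inFlight x t c = -(inFlight x t c * C (psi (c + 1))) := by
  refine C_psi_mul_psiStarSeries fun q hq => ?_
  obtain rfl : q = 0 := by omega
  simp [hopSeries]

theorem C_psi_mul_C_psiStar_self (k : ℤ) :
    C (psi (K := K) k) * C (psiStar k) = 1 - C (psiStar k) * C (psi k) := by
  rw [← map_mul, psi_mul_psiStar_self, map_sub, map_one, map_mul]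

theorem inFlight_mul_C_psiStar (x t : K) (k c : ℤ) :
    inFlight x t c * C (psiStar k) = -(C (psiStar k) * inFlight x t c) := by
  rw [← psiStarSeries_one, inFlight, psiStarSeries_anticomm]

/-! ### One column of the row -/

section Column

variable {x t : K} {c : ℤ} {B : Module.End K (Fock K)} {W : (Module.End K (Fock K))⟦X⟧}

/-- The names of these lemmas list the west, north and south arrows; balance fixes the east one.
Here `hB` says that the bra `B` has no particle in column `c + 1`, and `hW` that `W` produces none
there. Thus `ψ_{c+1}` can only be matched by the resident particle, which stays. -/
theorem vev_column_right_up_up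
    (hB : ∀ M, vevSeries (C B * (C (psiStar (c + 1)) * M)) = 0)
    (hW : ∀ M, vevSeries (M * (C (psi (c + 1)) * W)) = 0) :
    vevSeries (C (B * psi (c + 1)) * (psiStarSeries (c + 1) (hopSeries x t) * W)) =
      vevSeries (C B * W) := by
  have : C (B * psi (c + 1)) * (psiStarSeries (c + 1) (hopSeries x t) * W) =
      C B * W - C B * (C (psiStar (c + 1)) * (C (psi (c + 1)) * W)) -
        C B * inFlight x t c * (C (psi (c + 1)) * W) := by
    rw [psiStarSeries_hopSeries, map_mul, mul_assoc (C B), ← mul_assoc (C (psi (c + 1))), mul_add,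
      C_psi_mul_C_psiStar_self, C_psi_mul_inFlight]
    noncomm_ring
  rw [this, map_sub, map_sub, hB, hW, sub_zero, sub_zero]

theorem vev_column_right_up_down
    (hB : ∀ M, vevSeries (C B * (C (psiStar (c + 1)) * M)) = 0) :
    vevSeries (C B * (psiStarSeries (c + 1) (hopSeries x t) * W)) =
      vevSeries (C B * (inFlight x t c * W)) := by
  rw [psiStarSeries_hopSeries, add_mul, mul_add, map_add, hB, zero_add]

theorem vev_column_left_down_down
    (hB : ∀ M, vevSeries (C B * (C (psiStar (c + 1)) * M)) = 0) :
    vevSeries (C B * (inFlight x t (c + 1) * W)) =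
      x • (X * vevSeries (C B * (inFlight x t c * W))) := by
  rw [inFlight_succ, add_mul, mul_add, map_add, smul_mul_assoc, mul_smul_comm, X_mul (φ := C _),
    mul_assoc, map_smul, hB, smul_zero, zero_add, smul_mul_assoc, mul_smul_comm, map_smul,
    ← vevSeries_X_mul, mul_assoc, ← mul_assoc, ← X_mul, mul_assoc]

theorem vev_column_left_down_up
    (hB : ∀ M, vevSeries (C B * (C (psiStar (c + 1)) * M)) = 0)
    (hW : ∀ M, vevSeries (M * (C (psi (c + 1)) * W)) = 0) :
    vevSeries (C (B * psi (c + 1)) * (inFlight x t (c + 1) * W)) =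
      (x * (t + 1)) • (X * vevSeries (C B * W)) := by
  have : C (B * psi (c + 1)) * (inFlight x t (c + 1) * W) =
      (x * (t + 1)) • (X * (C B * W - C B * (C (psiStar (c + 1)) * (C (psi (c + 1)) * W)))) -
        x • (X * (C B * inFlight x t c * (C (psi (c + 1)) * W))) := by
    have h1 : C B * C (psi (c + 1)) * (X * C (psiStar (c + 1)) * W) =
        X * (C B * (C (psi (c + 1)) * C (psiStar (c + 1))) * W) := by
      rw [mul_assoc X, ← mul_assoc _ X, ← X_mul]; noncomm_ring
    have h2 : C B * C (psi (c + 1)) * (X * inFlight x t c * W) =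
        X * (C B * (C (psi (c + 1)) * inFlight x t c) * W) := by
      rw [mul_assoc X, ← mul_assoc _ X, ← X_mul]; noncomm_ring
    rw [inFlight_succ, map_mul, add_mul, mul_add, smul_mul_assoc, mul_smul_comm, smul_mul_assoc,
      mul_smul_comm, h1, h2, C_psi_mul_C_psiStar_self, C_psi_mul_inFlight,
      sub_eq_add_neg _ (x • _), ← smul_neg]
    congr 2 <;> noncomm_ring
  rw [this, map_sub, map_smul, map_smul, vevSeries_X_mul, vevSeries_X_mul, hW, map_sub, hB]
  simp

/-- A direct and an exchange term compete. The arriving particle lands and the resident leaves, with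
weight `x(t + 1)`, or it flies over the resident, with weight `x` and a sign from anticommutation;
the sum is `tx`. Two landings or two flights vanish. -/
theorem vev_column_left_up_up [CharZero K]
    (hB : ∀ M, vevSeries (C B * (C (psiStar (c + 1)) * M)) = 0) :
    vevSeries (C (B * psi (c + 1)) *
        (inFlight x t (c + 1) * (psiStarSeries (c + 1) (hopSeries x t) * W))) =
      (t * x) • (X * vevSeries (C B * (inFlight x t c * W))) := by
  have h0 : C (psiStar (K := K) (c + 1)) * C (psiStar (c + 1)) = 0 := by
    rw [← map_mul, psiStar_mul_psiStar_self, map_zero]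
  have h1 : inFlight x t c * inFlight x t c = 0 := psiStarSeries_mul_self _ _
  have hprod : inFlight x t (c + 1) * psiStarSeries (c + 1) (hopSeries x t) =
      (t * x) • (X * (C (psiStar (c + 1)) * inFlight x t c)) := by
    rw [inFlight_succ, psiStarSeries_hopSeries, mul_add, add_mul, add_mul, smul_mul_assoc,
      smul_mul_assoc, smul_mul_assoc, smul_mul_assoc, mul_assoc X, mul_assoc X, mul_assoc X,
      mul_assoc X, h0, h1, inFlight_mul_C_psiStar, mul_zero, smul_zero, smul_zero, zero_add,
      add_zero, mul_neg, smul_neg, add_comm, ← sub_eq_add_neg, ← sub_smul]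
    congr 1
    ring
  have : C (B * psi (c + 1)) *
        (inFlight x t (c + 1) * (psiStarSeries (c + 1) (hopSeries x t) * W)) =
      (t * x) • (X * (C B * (inFlight x t c * W) -
        C B * (C (psiStar (c + 1)) * (C (psi (c + 1)) * (inFlight x t c * W))))) := by
    have h2 : C B * C (psi (c + 1)) * (X * (C (psiStar (c + 1)) * inFlight x t c) * W) =
        X * (C B * (C (psi (c + 1)) * C (psiStar (c + 1))) * (inFlight x t c * W)) := by
      rw [mul_assoc X, ← mul_assoc _ X, ← X_mul]; noncomm_ring
    rw [← mul_assoc (inFlight x t (c + 1)), hprod, map_mul, smul_mul_assoc, mul_smul_comm, h2,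
      C_psi_mul_C_psiStar_self]
    congr 1
    noncomm_ring
  rw [this, map_smul, vevSeries_X_mul, map_sub, hB, sub_zero]

end Column

end Series

/-! ### Splitting off the leftmost column of a row of vertical edges. -/

section Columns

theorem upColumns_succ {L : ℕ} (v : Fin (L + 1) → Vert) :
    upColumns v = if v (Fin.last L) = .up then (L + 1) :: upColumns (fun c => v c.castSucc)
      else upColumns (fun c => v c.castSucc) := by
  have himg : ((Finset.univ.filter fun c => v c = .up).image fun c : Fin (L + 1) => (c : ℕ) + 1) =
      if v (Fin.last L) = .up then insert (L + 1) ((Finset.univ.filter fun c : Fin L =>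
          v c.castSucc = .up).image fun c : Fin L => (c : ℕ) + 1)
        else (Finset.univ.filter fun c : Fin L => v c.castSucc = .up).image
          fun c : Fin L => (c : ℕ) + 1 := by
    split_ifs with h <;> ext m <;>
      simp [Fin.exists_fin_succ', h, or_comm, @eq_comm _ m]
  unfold upColumns
  rw [himg]
  split_ifs with h
  · refine Finset.sort_insert _ (fun m hm => ?_) fun hm => ?_
    all_goals
      obtain ⟨c, -, hc⟩ := Finset.mem_image.1 hm
      omega
  · rfl

theorem mem_upColumns {L : ℕ} (v : Fin L → Vert) {m : ℕ} (h : m ∈ upColumns v) :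
    0 < m ∧ m ≤ L := by
  simp only [upColumns, Finset.mem_sort, Finset.mem_image] at h
  obtain ⟨c, -, rfl⟩ := h
  omega

end Columns

/-! ### A whole row of `Δ` ice as a matrix element. -/

section Rows

variable {K : Type*} [Field K]

open PowerSeries

/-- The operator `ψ*_{ν₁-1/2} ⋯ ψ*_{ν_r-1/2}`. -/
noncomputable def ketOp (ν : List ℕ) : Module.End K (Fock K) :=
  (ν.map fun m => psiStar (m : ℤ)).prod

/-- The operator `ψ_{μ_s-1/2} ⋯ ψ_{μ₁-1/2}`. -/
noncomputable def braOp (μ : List ℕ) : Module.End K (Fock K) :=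
  (μ.reverse.map fun m => psi (m : ℤ)).prod

theorem ketOp_cons (m : ℕ) (ν : List ℕ) :
    ketOp (K := K) (m :: ν) = psiStar (m : ℤ) * ketOp ν := by simp [ketOp]

theorem braOp_cons (m : ℕ) (μ : List ℕ) :
    braOp (K := K) (m :: μ) = braOp μ * psi (m : ℤ) := by simp [braOp]

/-- The product of the series `e^{φ_+} ψ*_{ν_j-1/2} e^{-φ_+}`. -/
noncomputable def ketSeries (x t : K) (ν : List ℕ) : (Module.End K (Fock K))⟦X⟧ :=
  (ν.map fun m : ℕ => psiStarSeries (m : ℤ) (hopSeries x t)).prod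

theorem ketSeries_cons (x t : K) (m : ℕ) (ν : List ℕ) :
    ketSeries x t (m :: ν) = psiStarSeries (m : ℤ) (hopSeries x t) * ketSeries x t ν := by
  simp [ketSeries]

theorem opExp_phiPlus_mul_ketOp [CharZero K] (x t : K) (ν : List ℕ) :
    opExp (phiPlus x t) * C (ketOp ν) = ketSeries x t ν * opExp (phiPlus x t) := by
  induction ν with
  | nil => simp [ketOp, ketSeries]
  | cons m ν ih =>
    rw [ketOp_cons, ketSeries_cons, map_mul, ← mul_assoc, opExp_phiPlus_mul_psiStar, mul_assoc, ih,
      mul_assoc]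

theorem vevSeries_mul_C_of_vacuum (F : (Module.End K (Fock K))⟦X⟧) {b : Module.End K (Fock K)}
    (hb : b vacuum = 0) : vevSeries (F * C b) = 0 := by
  ext1 N
  rw [coeff_vevSeries, coeff_mul_C, vev, Module.End.mul_apply, hb]
  simp

theorem vevSeries_C_psiStar_mul {k : ℤ} (hk : 0 < k) (F : (Module.End K (Fock K))⟦X⟧) :
    vevSeries (C (psiStar k) * F) = 0 := by
  ext1 N
  rw [coeff_vevSeries, coeff_C_mul, vev_psiStar_mul hk, map_zero]

/-- `ψ*_k` anticommutes with every factor of the bra and is killed by `⟨0|`. -/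
theorem vevSeries_braOp_psiStar {k : ℤ} (hk : 0 < k) (μ : List ℕ) (hμ : ∀ m ∈ μ, (m : ℤ) ≠ k)
    (F : (Module.End K (Fock K))⟦X⟧) : vevSeries (C (braOp μ) * (C (psiStar k) * F)) = 0 := by
  induction μ generalizing F with
  | nil => simpa [braOp] using vevSeries_C_psiStar_mul hk F
  | cons m μ ih =>
    have h1 : C (psi (m : ℤ)) * (C (psiStar k) * F) = -(C (psiStar k) * (C (psi (m : ℤ)) * F)) := by
      rw [← mul_assoc, ← map_mul, psi_mul_psiStar (hμ m (by simp)), map_neg, map_mul, neg_mul,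
        mul_assoc]
    rw [braOp_cons, map_mul C, mul_assoc, h1, mul_neg, map_neg,
      ih (fun m' hm' => hμ m' (by simp [hm'])), neg_zero]

/-- Hops only lower positions, so particles starting below `k` never reach `k`, and `ψ_k` passes
through to `b |0⟩`. -/
theorem vevSeries_psi_ketSeries {x t : K} {k : ℤ} {b : Module.End K (Fock K)}
    (hb : psi k (b vacuum) = 0) (ν : List ℕ) (hν : ∀ m ∈ ν, (m : ℤ) < k)
    (F : (Module.End K (Fock K))⟦X⟧) :
    vevSeries (F * (C (psi k) * (ketSeries x t ν * C b))) = 0 := by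
  induction ν generalizing F with
  | nil =>
    have := vevSeries_mul_C_of_vacuum F (b := psi k * b) hb
    simpa [ketSeries] using this
  | cons m ν ih =>
    have h1 : C (psi k) * (ketSeries x t (m :: ν) * C b) =
        -(psiStarSeries (m : ℤ) (hopSeries x t) * (C (psi k) * (ketSeries x t ν * C b))) := by
      rw [ketSeries_cons, mul_assoc, ← mul_assoc, C_psi_mul_psiStarSeries, neg_mul, mul_assoc]
      intro q hq
      have := hν m (by simp)
      omega
    rw [h1, mul_neg, map_neg, ← mul_assoc, ih (fun m' hm' => hν m' (by simp [hm'])), neg_zero]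

/-- The operator carried by the western edge of a row whose columns are numbered `L, …, 1`. -/
noncomputable def incoming (x t : K) (L : ℕ) : Horiz → (Module.End K (Fock K))⟦X⟧
  | .left => inFlight x t L
  | .right => 1

/-- A row of `Δ` ice, with free horizontal ends, as a matrix element of fermions. -/
theorem sumsTo_row [CharZero K] {x t : K} {b : Module.End K (Fock K)} {w : Horiz → K}
    (hb : ∀ k : ℤ, 0 < k → psi k (b vacuum) = 0)
    (hw : ∀ e, SumsTo (vevSeries (incoming x t 0 e * C b)) (w e)) {L : ℕ}
    (top bot : Fin L → Vert) (h : Fin (L + 1) → Horiz)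
    (bal : ∀ c, inDegree (h c.succ) (top c) (h c.castSucc) (bot c) =
      outDegree (h c.succ) (top c) (h c.castSucc) (bot c)) :
    SumsTo (vevSeries (C (braOp (upColumns bot)) *
        (incoming x t L (h (Fin.last L)) * (ketSeries x t (upColumns top) * C b))))
      ((∏ c, weightDelta x t (h c.succ) (top c) (h c.castSucc) (bot c)) * w (h 0)) := by
  induction L with
  | zero => simpa [upColumns, braOp, ketSeries] using hw (h 0)
  | succ L ih =>
    have IH := ih (fun c => top c.castSucc) (fun c => bot c.castSucc) (fun c => h c.castSucc)
      (fun c => bal c.castSucc)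
    have hbal := bal (Fin.last L)
    rw [Fin.prod_univ_castSucc, upColumns_succ top, upColumns_succ bot]
    set ν := upColumns fun c : Fin L => top c.castSucc with hν
    set μ := upColumns fun c : Fin L => bot c.castSucc with hμ
    have hB : ∀ M : (Module.End K (Fock K))⟦X⟧, vevSeries (C (braOp μ) * (C (psiStar ((L : ℤ) + 1)) * M)) = 0 :=
      vevSeries_braOp_psiStar (by omega) μ fun m hm => by
        have := mem_upColumns _ hm
        omega
    have hW : ∀ M, vevSeries (M * (C (psi ((L : ℤ) + 1)) * (ketSeries x t ν * C b))) = 0 :=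
      vevSeries_psi_ketSeries (hb _ (by omega)) ν fun m hm => by
        have := mem_upColumns _ hm
        omega
    simp only [Fin.succ_last, Fin.castSucc_zero, ← Fin.succ_castSucc] at IH hbal ⊢
    set P := ∏ c : Fin L, weightDelta x t (h c.castSucc.succ) (top c.castSucc) (h c.castSucc.castSucc)
      (bot c.castSucc) with hP
    clear_value P ν μ
    -- Balance leaves the six vertices, handled below. The series variable produced by each step of
    -- a flight disappears at `z = 1`; an empty column that no particle enters contributes nothing.
    cases hwest : h (Fin.last (L + 1)) <;> cases heast : h (Fin.last L).castSucc <;>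
      cases htop : top (Fin.last L) <;> cases hbot : bot (Fin.last L) <;>
      rw [hwest, heast, htop, hbot] at hbal <;> rw [heast] at IH <;>
      first
      | exact absurd hbal (by decide)
      | simp only [incoming, weightDelta, if_true, if_false, reduceCtorEq, braOp_cons,
          ketSeries_cons, one_mul, mul_one, Nat.cast_add, Nat.cast_one] at IH ⊢
    · rw [mul_assoc (psiStarSeries _ _), vev_column_left_up_up hB,
        show P * (t * x) * w (h 0) = t * x * (P * w (h 0)) by ring]
      exact IH.X_mul.smul _
    · rw [vev_column_left_down_down hB, show P * x * w (h 0) = x * (P * w (h 0)) by ring]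
      exact IH.X_mul.smul _
    · rw [vev_column_left_down_up hB hW,
        show P * (x * (t + 1)) * w (h 0) = x * (t + 1) * (P * w (h 0)) by ring]
      exact IH.X_mul.smul _
    · rwa [mul_assoc (psiStarSeries _ _), vev_column_right_up_down hB]
    · rwa [mul_assoc (psiStarSeries _ _), vev_column_right_up_up hB hW]
    · exact IH

end Rows

/-! ### Transposition, which exchanges `φ_-` with `φ_+` and bras with kets. -/

section Transpose

variable {K : Type*} [Field K]

open PowerSeries

/-- The bilinear form on Fock space for which the Maya diagrams are orthonormal. -/
noncomputable def pairing : Fock K →ₗ[K] Fock K →ₗ[K] K :=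
  Finsupp.linearCombination K fun S : Maya => Finsupp.lapply S

theorem pairing_single_left (S : Maya) (w : Fock K) : pairing (Finsupp.single S 1) w = w S := by
  simp [pairing, Finsupp.linearCombination_single]

theorem pairing_single_right (S : Maya) (v : Fock K) : pairing v (Finsupp.single S 1) = v S := by
  refine fock_induction (p := fun v => pairing v (Finsupp.single S 1) = v S) (by simp)
    (fun v w hv hw => by simp [hv, hw]) (fun T c => ?_) v
  classical
  rw [map_smul, LinearMap.smul_apply, pairing_single_left, Finsupp.smul_apply,
    Finsupp.single_apply, Finsupp.single_apply]
  simp only [eq_comm]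

/-- `a'` is the transpose of `a` with respect to `pairing`. -/
def IsTranspose (a a' : Module.End K (Fock K)) : Prop :=
  ∀ v w, pairing (a v) w = pairing v (a' w)

theorem isTranspose_of_single {a a' : Module.End K (Fock K)}
    (h : ∀ S T : Maya, a (Finsupp.single S 1) T = a' (Finsupp.single T 1) S) :
    IsTranspose a a' := by
  intro v w
  refine fock_induction (p := fun v => pairing (a v) w = pairing v (a' w)) (by simp)
    (fun v w hv hw => by simp [hv, hw]) (fun S c => ?_) v
  refine fock_induction (p := fun w => pairing (a (c • Finsupp.single S 1)) w =
    pairing (c • Finsupp.single S 1) (a' w)) (by simp)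
    (fun v w hv hw => by simp only [map_add, hv, hw]) (fun T d => ?_) w
  simp only [map_smul, LinearMap.smul_apply, pairing_single_left, pairing_single_right, h]

namespace IsTranspose

variable {a a' b b' : Module.End K (Fock K)}

theorem zero : IsTranspose (0 : Module.End K (Fock K)) 0 := fun v w => by simp

theorem one : IsTranspose (1 : Module.End K (Fock K)) 1 := fun v w => by simp

theorem add (h : IsTranspose a a') (h' : IsTranspose b b') : IsTranspose (a + b) (a' + b') :=
  fun v w => by simp only [LinearMap.add_apply, map_add, h v w, h' v w]

theorem smul (c : K) (h : IsTranspose a a') : IsTranspose (c • a) (c • a') :=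
  fun v w => by simp only [LinearMap.smul_apply, map_smul, h v w]

theorem mul (h : IsTranspose a a') (h' : IsTranspose b b') : IsTranspose (a * b) (b' * a') :=
  fun v w => by simp only [Module.End.mul_apply, h _ w, h' v _]

theorem sum {ι : Type*} {s : Finset ι} {f g : ι → Module.End K (Fock K)}
    (h : ∀ i ∈ s, IsTranspose (f i) (g i)) : IsTranspose (∑ i ∈ s, f i) (∑ i ∈ s, g i) := by
  classical
  induction s using Finset.induction_on with
  | empty => simpa using zero
  | insert i s hi ih =>
    rw [Finset.sum_insert hi, Finset.sum_insert hi]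
    exact (h i (by simp)).add (ih fun j hj => h j (by simp [hj]))

theorem symm (h : IsTranspose a a') : IsTranspose a' a :=
  isTranspose_of_single fun S T => by
    rw [← pairing_single_left, ← h, pairing_single_right]

theorem vev_eq (h : IsTranspose a a') : vev a = vev a' := by
  unfold vev vacuum
  rw [← pairing_single_right, h, pairing_single_left]

end IsTranspose

/-- The signs agree because they count only particles strictly to the right of `k`, whose number
does not depend on whether `k` is occupied. -/
theorem isTranspose_psi (k : ℤ) : IsTranspose (psi (K := K) k) (psiStar k) := by
  classical
  refine isTranspose_of_single fun S T => ?_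
  by_cases hS : k ∈ S.1
  · rw [psi_of_mem hS]
    by_cases hT : k ∈ T.1
    · have : S.clear k ≠ T := fun h => ((S.mem_clear k k).1 (h ▸ hT)).2 rfl
      rw [psiStar_of_mem hT]
      simp [this]
    · rw [psiStar_of_notMem hT]
      by_cases h : S.clear k = T
      · subst h
        rw [S.fill_clear hS, S.above_clear_of_le hS le_rfl]
        simp
      · have : T.fill k ≠ S := fun h' => h (h' ▸ T.clear_fill hT)
        simp [this, h]
  · rw [psi_of_notMem hS]
    by_cases hT : k ∈ T.1
    · rw [psiStar_of_mem hT]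
      simp
    · have : T.fill k ≠ S := fun h => hS (h ▸ Or.inl rfl)
      rw [psiStar_of_notMem hT]
      simp [this]

theorem isTranspose_psiStar (k : ℤ) : IsTranspose (psiStar (K := K) k) (psi k) :=
  (isTranspose_psi k).symm

/-- For `n ≠ 0` normal ordering is immaterial. The transpose of `ψ*_{i-n} ψ_i` is `ψ*_i ψ_{i-n}`,
which is the term of index `i - n` in `J_{-n}`. -/
theorem isTranspose_J {n : ℤ} (hn : n ≠ 0) : IsTranspose (J (K := K) n) (J (-n)) := by
  intro v w
  rw [J_apply, J_apply,
    ← finsum_comp_equiv (Equiv.subRight n) (f := fun i : ℤ => normalPair (i - -n) i w)]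
  have h1 := (pairing.flip w).toAddMonoidHom.map_finsum (finite_support_normalPair n v)
  have hfin := (finite_support_normalPair (-n) w).preimage
    (Equiv.subRight n).injective.injOn
  have h2 := (pairing v).toAddMonoidHom.map_finsum (f := fun i : ℤ =>
    normalPair ((Equiv.subRight n) i - -n) ((Equiv.subRight n) i) w) hfin
  refine h1.trans (Eq.trans (finsum_congr fun i => ?_) h2.symm)
  have ht : IsTranspose (normalPair (K := K) (i - n) i)
      (normalPair ((Equiv.subRight n) i - -n) ((Equiv.subRight n) i)) := by
    have e : (Equiv.subRight n) i - -n = i := by simp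
    rw [e, Equiv.subRight_apply, normalPair_of_ne (by omega), normalPair_of_ne (by omega)]
    exact (isTranspose_psiStar _).mul (isTranspose_psi _)
  exact ht v w

theorem isTranspose_ketOp (ν : List ℕ) : IsTranspose (ketOp (K := K) ν) (braOp ν) := by
  induction ν with
  | nil => simpa [ketOp, braOp] using IsTranspose.one
  | cons m ν ih =>
    rw [ketOp_cons, braOp_cons]
    exact (isTranspose_psiStar _).mul ih

theorem coeff_phiMinus_inv (x t : K) (q : ℕ) :
    coeff q (phiMinus x⁻¹ t) = coeff q (phiScalar x t) • J (-(q : ℤ)) := by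
  simp only [phiMinus, phiScalar, coeff_mk]
  split_ifs <;> simp

theorem isTranspose_coeff_phi (x t : K) (q : ℕ) :
    IsTranspose (coeff q (phiMinus x⁻¹ t)) (coeff q (phiPlus x t)) := by
  rw [coeff_phiMinus_inv, coeff_phiPlus]
  rcases eq_or_ne q 0 with rfl | hq
  · rw [coeff_zero_phiScalar, zero_smul, zero_smul]
    exact IsTranspose.zero
  · exact (isTranspose_J (by exact_mod_cast hq)).symm.smul _

theorem isTranspose_coeff_opExp (x t : K) (N : ℕ) :
    IsTranspose (coeff N (opExp (phiMinus x⁻¹ t))) (coeff N (opExp (phiPlus x t))) := by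
  have hpow : ∀ k N : ℕ, IsTranspose (coeff N (phiMinus x⁻¹ t ^ k)) (coeff N (phiPlus x t ^ k)) := by
    intro k
    induction k with
    | zero =>
      intro N
      rw [pow_zero, pow_zero, coeff_one]
      split_ifs
      · exact IsTranspose.one
      · exact IsTranspose.zero
    | succ k ih =>
      intro N
      rw [pow_succ, pow_succ', coeff_mul, coeff_mul, ← Finset.Nat.sum_antidiagonal_swap]
      exact IsTranspose.sum fun p _ => (ih _).mul (isTranspose_coeff_phi x t _)
  rw [opExp, opExp, coeff_mk, coeff_mk]
  exact IsTranspose.sum fun k _ => (hpow k N).smul _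

/-- Under transposition `ψ_{L+1}` becomes a creation operator, hence one more part `L + 1` of the
ket. It must first be moved next to the bra, past `ψ*_0`, which changes the sign of `β₁`. -/
theorem braket_phiMinus_eq (x t β₁ β₂ : K) (L : ℕ) (κ μ : List ℕ) :
    braket κ (C ((β₁ • psiStar 0 + β₂ • 1) * psi ((L : ℤ) + 1)) * opExp (phiMinus x⁻¹ t)) μ =
      braket μ (opExp (phiPlus x t) * C ((-β₁) • psi 0 + β₂ • 1)) ((L + 1) :: κ) := by
  unfold braket
  refine finsum_congr fun N => ?_
  change vev (braOp κ * _ * ketOp μ) = vev (braOp μ * _ * ketOp ((L + 1) :: κ))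
  have h1 : (β₁ • psiStar (K := K) 0 + β₂ • 1) * psi ((L : ℤ) + 1) =
      psi ((L : ℤ) + 1) * ((-β₁) • psiStar 0 + β₂ • 1) := by
    rw [add_mul, mul_add, smul_mul_assoc, psiStar_mul_psi (by omega), mul_smul_comm, smul_neg,
      neg_smul, smul_mul_assoc, mul_smul_comm, one_mul, mul_one]
  have ht := ((isTranspose_ketOp (K := K) κ).symm.mul (((isTranspose_psi ((L : ℤ) + 1)).mul
    (((isTranspose_psiStar (K := K) 0).smul (-β₁)).add (IsTranspose.one.smul β₂))).mul
      (isTranspose_coeff_opExp x t N))).mul (isTranspose_ketOp μ)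
  rw [h1, coeff_C_mul, coeff_mul_C, ht.vev_eq, ketOp_cons]
  push_cast
  simp only [mul_assoc]

end Transpose

/-! ### The right end of the row, and the bra-ket of a `Δ` row. -/

section MatrixElements

variable {K : Type*} [Field K]

open PowerSeries

theorem coeff_opExp_phiPlus_apply {x t : K} {v : Fock K} (hv : ∀ q : ℤ, 0 < q → J q v = 0)
    (N : ℕ) : coeff N (opExp (phiPlus x t)) v = if N = 0 then v else 0 := by
  have hφ : ∀ q : ℕ, coeff q (phiPlus x t) v = 0 := by
    intro q
    rw [coeff_phiPlus]
    rcases eq_or_ne q 0 with rfl | hq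
    · simp [coeff_zero_phiScalar]
    · rw [LinearMap.smul_apply, hv _ (by omega), smul_zero]
  have hpow : ∀ k : ℕ, coeff N (phiPlus x t ^ (k + 1)) v = 0 := by
    intro k
    rw [pow_succ, coeff_mul, LinearMap.sum_apply]
    refine Finset.sum_eq_zero fun p _ => ?_
    rw [Module.End.mul_apply, hφ, map_zero]
  rw [opExp, coeff_mk, Finset.sum_range_succ', LinearMap.add_apply, LinearMap.sum_apply,
    Finset.sum_eq_zero fun k _ => by rw [LinearMap.smul_apply, hpow, smul_zero], zero_add,
    pow_zero, coeff_one]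
  split_ifs <;> simp

theorem vevSeries_opExp_phiPlus {x t : K} (F : (Module.End K (Fock K))⟦X⟧)
    {b : Module.End K (Fock K)} (hb : ∀ q : ℤ, 0 < q → J q (b vacuum) = 0) :
    vevSeries (F * opExp (phiPlus x t) * C b) = vevSeries (F * C b) := by
  ext1 N
  rw [coeff_vevSeries, coeff_vevSeries, coeff_mul_C, coeff_mul_C, vev, vev, Module.End.mul_apply,
    Module.End.mul_apply, coeff_mul, LinearMap.sum_apply,
    Finset.sum_eq_single (N, 0)]
  · rw [Module.End.mul_apply, coeff_opExp_phiPlus_apply hb, if_pos rfl]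
  · rintro ⟨p, q⟩ hp hne
    have := Finset.HasAntidiagonal.mem_antidiagonal.1 hp
    have hq : q ≠ 0 := fun h => hne (by simp_all)
    rw [Module.End.mul_apply, coeff_opExp_phiPlus_apply hb, if_neg hq, map_zero]
  · intro h
    simp at h

theorem psi_zero_mul_ketOp (ν : List ℕ) (hν : ∀ m ∈ ν, 0 < m) :
    psi (K := K) 0 * ketOp ν = (-1 : K) ^ ν.length • (ketOp ν * psi 0) := by
  induction ν with
  | nil => simp [ketOp]
  | cons m ν ih =>
    have := hν m (by simp)
    rw [ketOp_cons, ← mul_assoc, psi_mul_psiStar (by omega), neg_mul, mul_assoc,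
      ih fun m' hm' => hν m' (by simp [hm']), mul_smul_comm, List.length_cons, pow_succ, mul_assoc,
      mul_neg_one, neg_smul]

/-- A particle flying out past column 1 finds only one empty position, the hole at `0`, and reaches
it by `q = 1`. -/
theorem sumsTo_inFlight_zero_psi_zero (x t : K) :
    SumsTo (vevSeries (inFlight x t 0 * C (psi 0))) (x * (t + 1)) := by
  have : vevSeries (inFlight x t 0 * C (psi 0)) = (x * (t + 1)) • (X * 1) := by
    ext1 N
    rw [coeff_vevSeries, coeff_mul_C, inFlight, coeff_psiStarSeries, mul_one, coeff_smul_apply,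
      coeff_X, vev, smul_mul_assoc, LinearMap.smul_apply, Module.End.mul_apply, Finsupp.smul_apply]
    rcases N with _ | _ | N
    · simp [hopSeries]
    · have h1 : psiStar (K := K) 0 (psi 0 vacuum) = vacuum := by
        have := congrArg (fun a : Module.End K (Fock K) => a vacuum)
          (psi_psiStar_anticomm (K := K) 0 0)
        simpa [psiStar_vacuum] using this
      simp only [zero_add, Nat.cast_one, sub_self, h1]
      simp [hopSeries, coeff_one, vacuum]
      ring
    · rw [← Module.End.mul_apply, psiStar_mul_psi (by push_cast; omega), LinearMap.neg_apply,
        Module.End.mul_apply, psiStar_vacuum (by push_cast; omega)]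
      simp
  rw [this]
  simpa only [mul_one] using SumsTo.one.X_mul.smul (x * (t + 1))

theorem vevSeries_inFlight_zero (x t : K) : vevSeries (inFlight x t 0) = 0 := by
  ext1 N
  rw [coeff_vevSeries, inFlight, coeff_psiStarSeries, vev]
  rcases N with _ | N
  · simp [hopSeries]
  · rw [LinearMap.smul_apply, psiStar_vacuum (by push_cast; omega)]
    simp

theorem C_smul (c : K) (a : Module.End K (Fock K)) :
    (C (c • a) : (Module.End K (Fock K))⟦X⟧) = c • C a := by
  ext1 N
  rw [coeff_smul_apply, coeff_C, coeff_C]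
  split_ifs <;> simp

theorem vevSeries_opExp_ketOp [CharZero K] (x t : K) (μ ν : List ℕ) {b : Module.End K (Fock K)}
    (hb : ∀ q : ℤ, 0 < q → J q (b vacuum) = 0) :
    vevSeries (C (braOp μ) * (opExp (phiPlus x t) * C (ketOp ν * b))) =
      vevSeries (C (braOp μ) * (ketSeries x t ν * C b)) := by
  have h : C (braOp μ) * (opExp (phiPlus x t) * C (ketOp ν * b)) =
      C (braOp μ) * ketSeries x t ν * opExp (phiPlus x t) * C b := by
    rw [map_mul C, ← mul_assoc (opExp _), opExp_phiPlus_mul_ketOp, ← mul_assoc, ← mul_assoc]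
  rw [h, vevSeries_opExp_phiPlus _ hb, mul_assoc]

/-- Once `ψ_0` is moved to the vacuum, at the cost of a sign per particle, `e^{φ_+}` can be moved
right as well: both `|0⟩` and `ψ_0 |0⟩` are killed by all `J_q` with `q > 0`, so it acts there as
the identity. -/
theorem vevSeries_matrixElement [CharZero K] (x t α₁ α₂ : K) (μ ν : List ℕ)
    (hν : ∀ m ∈ ν, 0 < m) :
    vevSeries (C (braOp μ) * (opExp (phiPlus x t) * C (α₁ • psi 0 + α₂ • 1)) * C (ketOp ν)) =
      ((-1) ^ ν.length * α₁) • vevSeries (C (braOp μ) * (ketSeries x t ν * C (psi 0))) +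
        α₂ • vevSeries (C (braOp μ) * (ketSeries x t ν * C 1)) := by
  have hket : (α₁ • psi (K := K) 0 + α₂ • 1) * ketOp ν =
      ((-1) ^ ν.length * α₁) • (ketOp ν * psi 0) + α₂ • (ketOp ν * 1) := by
    rw [add_mul, smul_mul_assoc, psi_zero_mul_ketOp _ hν, smul_smul, mul_comm α₁, smul_mul_assoc,
      one_mul, mul_one]
  rw [← vevSeries_opExp_ketOp x t μ ν (b := psi 0) fun q hq => J_psi_zero_vacuum hq,
    ← vevSeries_opExp_ketOp x t μ ν (b := 1) fun q hq => J_vacuum hq, mul_assoc,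
    mul_assoc (opExp _), ← map_mul C, hket, map_add, C_smul, C_smul, mul_add, mul_smul_comm,
    mul_smul_comm, mul_add, mul_smul_comm, mul_smul_comm, map_add, map_smul, map_smul]

/-- A row of `Δ` ice whose left boundary edge points right as a bra-ket. -/
theorem braket_phiPlus_eq [CharZero K] (x t α₁ α₂ : K) {L : ℕ} (top bot : Fin L → Vert)
    (h : Fin (L + 1) → Horiz)
    (bal : ∀ c, inDegree (h c.succ) (top c) (h c.castSucc) (bot c) =
      outDegree (h c.succ) (top c) (h c.castSucc) (bot c))
    (hleft : h (Fin.last L) = .right) :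
    braket (upColumns bot) (opExp (phiPlus x t) * C (α₁ • psi 0 + α₂ • 1)) (upColumns top) =
      (∏ c, weightDelta x t (h c.succ) (top c) (h c.castSucc) (bot c)) *
        (if h 0 = .left then (-1) ^ (upColumns top).length * α₁ * (x * (t + 1)) else α₂) := by
  set P := ∏ c, weightDelta x t (h c.succ) (top c) (h c.castSucc) (bot c) with hP
  set ν := upColumns top with hν
  set μ := upColumns bot with hμ
  -- By charge, `b = 1` admits only an east end pointing right and `b = psi 0` only one pointing
  -- left.
  have row1 := sumsTo_row (x := x) (t := t) (b := 1) (w := fun e => if e = .left then 0 else 1)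
    (fun k hk => psi_vacuum hk) (fun e => by
      cases e
      · simpa [incoming, vevSeries_inFlight_zero] using SumsTo.zero (K := K)
      · have : vevSeries (1 : (Module.End K (Fock K))⟦X⟧) = 1 := by
          ext1 N
          rw [coeff_vevSeries, coeff_one, coeff_one]
          split_ifs
          · exact vev_one
          · simp [vev]
        simpa [incoming, this] using SumsTo.one (K := K)) top bot h bal
  have row2 := sumsTo_row (x := x) (t := t) (b := psi 0)
    (w := fun e => if e = .left then x * (t + 1) else 0)
    (fun k hk => by
      rw [← Module.End.mul_apply, psi_mul_psi, LinearMap.neg_apply, Module.End.mul_apply,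
        psi_vacuum hk, map_zero, neg_zero]) (fun e => by
      cases e
      · simpa [incoming] using sumsTo_inFlight_zero_psi_zero x t
      · have : vevSeries (C (psi (K := K) 0)) = 0 := by
          ext1 N
          rw [coeff_vevSeries, coeff_C]
          split_ifs
          · simpa using vev_psi_mul (K := K) (le_refl 0) 1
          · simp [vev]
        simpa [incoming, this] using SumsTo.zero (K := K)) top bot h bal
  rw [hleft, incoming, one_mul, ← hν, ← hμ, ← hP] at row1 row2
  have key := vevSeries_matrixElement x t α₁ α₂ μ ν fun m hm => (mem_upColumns _ hm).1
  have hsum := ((row2.smul ((-1) ^ ν.length * α₁)).add (row1.smul α₂))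
  rw [← key] at hsum
  refine Eq.trans ?_ (hsum.finsum_coeff.trans ?_)
  · refine finsum_congr fun N => ?_
    rw [coeff_vevSeries, coeff_mul_C N (C (braOp μ) * _), coeff_C_mul]
    rfl
  · split_ifs <;> ring

end MatrixElements

/-! ### Flux conservation, and the reduction of `Γ` rows to `Δ` rows. -/

section Ice

/-- Reversal of a horizontal edge. -/
def Horiz.flip : Horiz → Horiz
  | .left => .right
  | .right => .left

theorem length_upColumns_succ {L : ℕ} (v : Fin (L + 1) → Vert) :
    (upColumns v).length =
      (upColumns fun c => v c.castSucc).length + if v (Fin.last L) = .up then 1 else 0 := by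
  rw [upColumns_succ]
  split_ifs <;> simp

/-- Conservation of flux along a row. -/
theorem length_upColumns_row {L : ℕ} (top bot : Fin L → Vert) (h : Fin (L + 1) → Horiz)
    (bal : ∀ c, inDegree (h c.succ) (top c) (h c.castSucc) (bot c) =
      outDegree (h c.succ) (top c) (h c.castSucc) (bot c)) :
    (upColumns top).length + (if h 0 = .right then 1 else 0) =
      (upColumns bot).length + if h (Fin.last L) = .right then 1 else 0 := by
  induction L with
  | zero => simp [upColumns]
  | succ L ih =>
    have IH : (upColumns fun c => top c.castSucc).length + (if h 0 = .right then 1 else 0) =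
        (upColumns fun c => bot c.castSucc).length +
          if h (Fin.last L).castSucc = .right then 1 else 0 :=
      ih _ _ (fun c => h c.castSucc) fun c => bal c.castSucc
    have hbal := bal (Fin.last L)
    rw [length_upColumns_succ, length_upColumns_succ]
    rw [Fin.succ_last] at hbal
    cases hwest : h (Fin.last (L + 1)) <;> cases heast : h (Fin.last L).castSucc <;>
      cases htop : top (Fin.last L) <;> cases hbot : bot (Fin.last L) <;>
      rw [hwest, heast, htop, hbot] at hbal <;> rw [heast] at IH <;>
      first
      | exact absurd hbal (by decide)
      | simp only [if_true, if_false, reduceCtorEq] at IH ⊢; omega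

variable {K : Type*} [Field K]

/-- The gauge factor relating `Γ` ice to horizontally reversed `Δ` ice. -/
def gauge (t : K) : Horiz → K
  | .left => 1
  | .right => t + 1

theorem weightGamma_inv_mul {x t : K} (hx : x ≠ 0) {w e : Horiz} {n s : Vert}
    (bal : inDegree w n e s = outDegree w n e s) :
    weightGamma x⁻¹ t w n e s * x * gauge t w =
      weightDelta x t w.flip s e.flip n * gauge t e := by
  cases w <;> cases e <;> cases n <;> cases s <;>
    first
    | exact absurd bal (by decide)
    | simp [weightGamma, weightDelta, gauge, Horiz.flip, hx] <;> field_simp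

/-- Each inner edge contributes its gauge factor once on either side, so only those of the two ends
remain. -/
theorem prod_weightGamma_inv {x t : K} (hx : x ≠ 0) {L : ℕ} (top bot : Fin L → Vert)
    (h : Fin (L + 1) → Horiz)
    (bal : ∀ c, inDegree (h c.succ) (top c) (h c.castSucc) (bot c) =
      outDegree (h c.succ) (top c) (h c.castSucc) (bot c)) :
    (∏ c, weightGamma x⁻¹ t (h c.succ) (top c) (h c.castSucc) (bot c)) * x ^ L *
        gauge t (h (Fin.last L)) =
      (∏ c, weightDelta x t (h c.succ).flip (bot c) (h c.castSucc).flip (top c)) *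
        gauge t (h 0) := by
  induction L with
  | zero => simp
  | succ L ih =>
    have IH := ih (fun c => top c.castSucc) (fun c => bot c.castSucc) (fun c => h c.castSucc)
      (fun c => bal c.castSucc)
    have hg := weightGamma_inv_mul (x := x) (t := t) hx (bal (Fin.last L))
    rw [Fin.prod_univ_castSucc, Fin.prod_univ_castSucc, pow_succ]
    simp only [Fin.succ_last, Fin.castSucc_zero, ← Fin.succ_castSucc] at IH hg ⊢
    linear_combination (∏ c : Fin L, weightGamma x⁻¹ t (h c.castSucc.succ) (top c.castSucc)
        (h c.castSucc.castSucc) (bot c.castSucc)) * x ^ L * hg +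
      weightDelta x t (h (Fin.last (L + 1))).flip (bot (Fin.last L)) (h (Fin.last L).castSucc).flip
        (top (Fin.last L)) * IH

theorem balanced_flip {w e : Horiz} {n s : Vert} (bal : inDegree w n e s = outDegree w n e s) :
    inDegree w.flip s e.flip n = outDegree w.flip s e.flip n := by
  cases w <;> cases e <;> cases n <;> cases s <;> first | rfl | exact absurd bal (by decide)

/-- A row of `Γ` ice whose left boundary edge points right as a bra-ket: it is a row of reversed
`Δ` ice with one more column on the left. -/
theorem braket_phiMinus_row [CharZero K] {x t : K} (hx : x ≠ 0) (ht : t + 1 ≠ 0) (β₁ β₂ : K)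
    {L : ℕ} (top bot : Fin L → Vert) (h : Fin (L + 1) → Horiz)
    (bal : ∀ c, inDegree (h c.succ) (top c) (h c.castSucc) (bot c) =
      outDegree (h c.succ) (top c) (h c.castSucc) (bot c))
    (hleft : h (Fin.last L) = .right) :
    braket (upColumns bot)
        (PowerSeries.C ((β₁ • psiStar 0 + β₂ • 1) * psi ((L : ℤ) + 1)) * opExp (phiMinus x⁻¹ t))
        (upColumns top) =
      (∏ c, weightGamma x⁻¹ t (h c.succ) (top c) (h c.castSucc) (bot c)) * x ^ L * (t + 1) *
        (if h 0 = .left then β₂ else (-1) ^ (upColumns bot).length * β₁ * x) := by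
  -- After reversal the left boundary edge points left. A vertex `(→, ←; ↑, ↓)` of `Δ` weight `1` in
  -- column `L + 1` supplies this edge from a boundary pointing right; its northern up arrow is the
  -- particle from `ψ_{L+1}`.
  let bot' : Fin (L + 1) → Vert := Fin.snoc bot .up
  let top' : Fin (L + 1) → Vert := Fin.snoc top .down
  let h' : Fin (L + 2) → Horiz := Fin.snoc (fun c => (h c).flip) .right
  have hbot : upColumns bot' = (L + 1) :: upColumns bot := by
    rw [upColumns_succ]; simp [bot']
  have htop : upColumns top' = upColumns top := by
    rw [upColumns_succ]; simp [top']
  have hsucc : ∀ c : Fin L, h' c.castSucc.succ = (h c.succ).flip := by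
    intro c
    rw [Fin.succ_castSucc]
    exact Fin.snoc_castSucc (α := fun _ => Horiz) _ _ _
  have hbal : ∀ c, inDegree (h' c.succ) (bot' c) (h' c.castSucc) (top' c) =
      outDegree (h' c.succ) (bot' c) (h' c.castSucc) (top' c) := by
    intro c
    refine Fin.lastCases ?_ (fun c => ?_) c
    · simp [h', bot', top', hleft, Horiz.flip, inDegree, outDegree]
    · rw [hsucc]
      simpa [h', bot', top'] using balanced_flip (bal c)
  have key := braket_phiPlus_eq x t (-β₁) β₂ bot' top' h' hbal (by simp [h'])
  have hprod : ∏ c, weightDelta x t (h' c.succ) (bot' c) (h' c.castSucc) (top' c) =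
      ∏ c, weightDelta x t (h c.succ).flip (bot c) (h c.castSucc).flip (top c) := by
    rw [Fin.prod_univ_castSucc]
    simp only [hsucc]
    simp [h', bot', top', hleft, Horiz.flip, weightDelta]
  have hG := prod_weightGamma_inv (t := t) hx top bot h bal
  have h0 : h' 0 = (h 0).flip := by
    rw [← Fin.castSucc_zero]
    simp [h']
  rw [hleft] at hG
  rw [braket_phiMinus_eq, ← hbot, ← htop, key, hprod, hbot, h0]
  cases h00 : h 0
  · rw [h00] at hG
    simp only [gauge, mul_one] at hG
    rw [← hG]
    simp [Horiz.flip]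
  · rw [h00] at hG
    -- Both ends carry the gauge factor `t + 1`, which cancels here. The sign of the extra part `L +
    -- 1` cancels that of `-β₁`.
    rw [← mul_right_cancel₀ ht hG, List.length_cons, pow_succ]
    simp only [Horiz.flip, reduceCtorEq, if_true, if_false]
    ring

/-- In a double row, the two left boundary edges bring in two units of flux and exactly one leaves a
row at the bend, so the northern boundary has one up arrow more than the southern one. -/
theorem BentIce.length_part {n : ℕ} [NeZero n] {lam : Fin n → ℕ} (A : BentIce lam)
    (m : Fin (n + 1)) : (A.part m).length = m := by
  induction m using Fin.induction with
  | zero => simp [part, upColumns, A.bottom_boundary]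
  | succ i ih =>
    have h1 := length_upColumns_row _ _ _ (A.balanced i)
    have h2 := length_upColumns_row _ _ _ (A.balancedBar i)
    have hbend := A.bend i
    rw [A.left_boundary, if_pos rfl] at h1
    rw [A.left_boundaryBar, if_pos rfl] at h2
    rw [part, Fin.val_castSucc] at ih
    rw [part, Fin.val_succ]
    cases e1 : A.horiz i 0 <;> cases e2 : A.horizBar i 0 <;> rw [e1, e2] at hbend <;>
      rw [e1] at h1 <;> rw [e2] at h2 <;>
      simp only [reduceCtorEq, if_true, if_false, ne_eq, not_true_eq_false] at h1 h2 hbend <;>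
      omega

end Ice
end SixVertex

/-! ### The double row. -/

open SixVertex in
theorem mainTheorem4 {K : Type*} [Field K] [CharZero K] {n : ℕ} [NeZero n]
    (lam : Fin n → ℕ) (hlam : StrictAnti lam) (hpos : ∀ j, 0 < lam j)
    (x : Fin n → K) (t : K) (hx : ∀ j, x j ≠ 0) (ht : t + 1 ≠ 0)
    (A : BentIce lam) (i : Fin n) (α₁ α₂ β₁ β₂ : K)
    (hα₁ : α₁ = t / ((-1) ^ ((i : ℕ) + 1) * (t + 1)))
    (hα₂ : α₂ = (x i)⁻¹)
    (hβ₁ : β₁ = (-1) ^ (i : ℕ) / ((t + 1) * x i ^ (lam 0 + 1)))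
    (hβ₂ : β₂ = 1 / ((t + 1) * x i ^ lam 0)) :
    A.rowWeight x t i =
      braket (A.part i.castSucc)
          (PowerSeries.C ((β₁ • psiStar 0 + β₂ • 1) * psi ((lam 0 : ℤ) + 1)) *
            opExp (phiMinus (x i)⁻¹ t))
          (A.partBar i) *
        braket (A.partBar i)
          (opExp (phiPlus (x i) t) * PowerSeries.C (α₁ • psi 0 + α₂ • 1))
          (A.part i.succ) := by
  have hxi := hx i
  have hsign : ((-1 : K) ^ (i : ℕ)) * (-1) ^ (i : ℕ) = 1 := by
    rw [← mul_pow]; simp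
  have upper := braket_phiPlus_eq (x i) t α₁ α₂ _ _ _ (A.balanced i) (A.left_boundary i)
  have lower := braket_phiMinus_row hxi ht β₁ β₂ _ _ _ (A.balancedBar i) (A.left_boundaryBar i)
  have hlen := A.length_part i.succ
  have hlen' := A.length_part i.castSucc
  unfold BentIce.part at hlen hlen'
  rw [hlen] at upper
  rw [hlen'] at lower
  unfold BentIce.rowWeight BentIce.part BentIce.partBar
  -- The constants `α₁`, `α₂` make the right end of the upper row contribute the bend weight; the
  -- sign comes from the `i + 1` particles of the ket.
  have hup : (if A.horiz i 0 = .left then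
      (-1) ^ ((i.succ : Fin (n + 1)) : ℕ) * α₁ * (x i * (t + 1)) else α₂) =
      if A.horiz i 0 = .left then t * x i else (x i)⁻¹ := by
    split_ifs
    · rw [hα₁, Fin.val_succ]
      have : ((-1 : K) ^ ((i : ℕ) + 1)) ≠ 0 := pow_ne_zero _ (by simp)
      field_simp
    · exact hα₂
  -- The constants `β₁`, `β₂` cancel the normalisation and gauge factors of the lower row for either
  -- direction of the bend.
  have hlow : x i ^ lam 0 * ((t + 1) * (if A.horizBar i 0 = .left then β₂ else
      (-1) ^ ((i.castSucc : Fin (n + 1)) : ℕ) * β₁ * x i)) = 1 := by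
    split_ifs
    · rw [hβ₂]
      field_simp
    · rw [hβ₁, Fin.val_castSucc]
      have e : (x i) ^ lam 0 * ((t + 1) * ((-1) ^ (i : ℕ) *
          ((-1) ^ (i : ℕ) / ((t + 1) * x i ^ (lam 0 + 1))) * x i)) =
          ((-1) ^ (i : ℕ) * (-1) ^ (i : ℕ)) * ((t + 1) * x i ^ (lam 0 + 1)) /
            ((t + 1) * x i ^ (lam 0 + 1)) := by
        rw [pow_succ (x i)]; ring
      rw [e, hsign, one_mul, div_self (mul_ne_zero ht (pow_ne_zero _ hxi))]
  have combine : ∀ D G b e : K, x i ^ lam 0 * ((t + 1) * e) = 1 →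
      D * G * b = G * x i ^ lam 0 * (t + 1) * e * (D * b) := by
    intro D G b e he
    linear_combination (-(D * G * b)) * he
  rw [upper, lower, hup]
  exact combine _ _ _ _ hlow
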